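/- **Setting.** Let $n,m,d,q$ be integers, $n,m\ge 1$, let $\Theta\subseteq\mathbb R^d$ be convex and open, $(\mathsf Z,\mu)$ a measure space, and let $y_{ij}$ ($1\le i\le n$, $1\le j\le m$) be observations, $y_{ij}$ being held by worker $i$. For $\theta\in\Theta$ set $$p(y,z;\theta)=\rho(y,z)\exp\{\langle s(y,z),\phi(\theta)\rangle-\psi(\theta)\},\quad p(y;\theta)=\int p(y,z;\theta)\,\mu(dz),\quad \bar s_{ij}(\theta)=\int s(y_{ij},z)\,\frac{p(y_{ij},z;\theta)}{p(y_{ij};\theta)}\,\mu(dz),$$ $$F(\theta)=-\frac1{nm}\sum_{i=1}^n\sum_{j=1}^m\log p(y_{ij};\theta)+R(\theta),$$ where $R,\psi:\Theta\to\mathbb R$, $\phi:\Theta\to\mathbb R^q$, $\rho(y_{ij},\cdot):\mathsf Z\to\mathbb R_+$ and $s(y_{ij},\cdot):\mathsf Z\to\mathbb R^q$ are measurable. Assume that: 1. $0<p(y_{ij};\theta)<\infty$ and the integral $\bar s_{ij}(\theta)$ is well defined, for all $i,j$ and $\theta\in\Theta$. 2. For every $s\in\mathbb R^q$, $\theta\mapsto\psi(\theta)+R(\theta)-\langle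 s,\phi(\theta)\rangle$ has a unique minimizer $T(s)$ on $\Theta$. Set $h_i(s)=\frac1m\sum_j\bar s_{ij}(T(s))-s$, $h=\frac1n\sum_i h_i$ and $W=F\circ T$. 3. $W$ is $C^1$ on $\mathbb R^q$ and bounded below, its gradient is globally Lipschitz with constant $L_{\dot W}>0$, and $\nabla W(s)=-B(s)h(s)$ with $B(s)$ a positive definite $q\times q$ matrix whose spectrum lies in $[v_{\min},v_{\max}]$ for all $s$, where $0<v_{\min}\le v_{\max}$. 4. $\|(\bar s_{ij}(T(s))-s)-(\bar s_{ij}(T(s'))-s')\|\le L_{ij}\|s-s'\|$ for all $i,j,s,s'$. Set $L\ge0$, $L^2=\frac1{nm}\sum_{i,j}L_{ij}^2$. 5. $\mathrm{Quant}$ is a random (measurable) operator on $\mathbb R^q$ and $\omega\ge0$, with $\mathbb E[\mathrm{Quant}(s)]=s$ and $\mathbb E\|\mathrm{Quant}(s)\|^2\le(1+\omega)\|s\|^2$ for all $s\in\mathbb R^q$. **Algorithm (VR-FedEM).** Let $k_{\rm in},k_{\rm out}\ge1$, $$\alpha=\frac1{1+\omega},\qquad \mathsf b=\Big\lceil\frac{k_{\rm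 in}}{(1+\omega)^2}\Big\rceil,\qquad \gamma=\frac{v_{\min}}{L_{\dot W}}\Big(1+4\sqrt2\,\frac{v_{\max}}{L_{\dot W}}\frac{L}{\sqrt n}(1+\omega)\Big(\omega+\frac{1+10\omega}8\Big)^{1/2}\Big)^{-1}.$$ Start from a (possibly random) $\widehat S_{1,0}=\widehat S_{1,-1}$ with $W(\widehat S_{1,0})$ integrable, $V_{1,0,i}=h_i(\widehat S_{1,0})$, $V_{1,0}=\frac1n\sum_iV_{1,0,i}$ and $\mathsf S_{1,0,i}=\frac1m\sum_j\bar s_{ij}(T(\widehat S_{1,0}))$. For $t=1,\dots,k_{\rm out}$ and $k=0,\dots,k_{\rm in}-1$, each worker $i$ draws at random a batch $\mathcal B_{t,k+1,i}$ of size $\mathsf b$ in $\{1,\dots,m\}$ (uniformly, either always with or always without replacement) and sets $$\mathsf S_{t,k+1,i}=\mathsf S_{t,k,i}+\frac1{\mathsf b}\sum_{j\in\mathcal B_{t,k+1,i}}\big(\bar s_{ij}(T(\widehat S_{t,k}))-\bar s_{ij}(T(\widehat S_{t,k-1}))\big),\quad \Delta_{t,k+1,i}=\mathsf S_{t,k+1,i}-\widehat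 S_{t,k}-V_{t,k,i},$$ $$V_{t,k+1,i}=V_{t,k,i}+\alpha\,\mathrm{Quant}(\Delta_{t,k+1,i}),$$ and the server sets $$H_{t,k+1}=V_{t,k}+\frac1n\sum_i\mathrm{Quant}(\Delta_{t,k+1,i}),\quad \widehat S_{t,k+1}=\widehat S_{t,k}+\gamma H_{t,k+1},\quad V_{t,k+1}=V_{t,k}+\frac\alpha n\sum_i\mathrm{Quant}(\Delta_{t,k+1,i}).$$ At the end of outer loop $t$, $\widehat S_{t+1,0}=\widehat S_{t+1,-1}=\widehat S_{t,k_{\rm in}}$, $V_{t+1,0}=V_{t,k_{\rm in}}$, $V_{t+1,0,i}=V_{t,k_{\rm in},i}$ and $\mathsf S_{t+1,0,i}=\frac1m\sum_j\bar s_{ij}(T(\widehat S_{t+1,0}))$. The initial point, all the batches and all the draws of randomness of $\mathrm{Quant}$ (a fresh one for each worker and iteration) are mutually independent. **Theorem.** Let $(\tau,K)$ be uniform on $\{1,\dots,k_{\rm out}\}\times\{0,\dots,k_{\rm in}-1\}$ and independent of $\{\widehat S_{t,k}:1\le t\le k_{\rm out},\,0\le k\le k_{\rm in}\}$. Then $\|H_{\tau,K+1}\|^2$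 and $\|h(\widehat S_{\tau,K})\|^2$ are integrable, $$\mathbb E\big[\|H_{\tau,K+1}\|^2\big]\le\frac{2\big(\mathbb E[W(\widehat S_{1,0})]-\inf W\big)}{v_{\min}\,\gamma\,k_{\rm in}\,k_{\rm out}},$$ $$\mathbb E\big[\|h(\widehat S_{\tau,K})\|^2\big]\le2\Big(1+\gamma^2\frac{L^2(1+\omega)^2}{n}\Big)\mathbb E\big[\|H_{\tau,K+1}\|^2\big],$$ where $\inf W$ is $\min W$ when the minimum is attained. -/

import Mathlib

open MeasureTheory ProbabilityTheory
open scoped NNReal RealInnerProductSpace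

namespace VRFedEM

/-- The Euclidean space of dimension `q`. -/
abbrev Vec (q : ℕ) := EuclideanSpace ℝ (Fin q)

/-! ## The statistical model -/

/-- The data of a latent variable model from a curved exponential family: `n` workers, each holding
`m` observations `y i j`, a latent space `Z` with reference measure `μ`, a parameter set
`Θ ⊆ ℝ^d`, and the functions which define the complete-data likelihood and the penalty. -/
structure Model (n m d q : ℕ) (Y Z : Type*) [MeasurableSpace Z] where
  /-- parameter set -/
  Θ : Set (Vec d)
  /-- penalty -/
  R : Θ → ℝ
  /-- natural parameter -/
  φ : Θ → Vec q
  /-- log-partition function -/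
  ψ : Θ → ℝ
  /-- base density -/
  ρ : Y → Z → ℝ≥0
  /-- complete-data sufficient statistics -/
  s : Y → Z → Vec q
  /-- observations -/
  y : Fin n → Fin m → Y
  /-- reference measure on the latent space -/
  μ : Measure Z

namespace Model

variable {n m d q : ℕ} {Y Z : Type*} [MeasurableSpace Z]

/-- Complete-data likelihood `p(y, z; θ) = ρ(y, z) exp(⟨s(y, z), φ(θ)⟩ - ψ(θ))`. -/
noncomputable def completeLik (M : Model n m d q Y Z) (y : Y) (z : Z) (θ : M.Θ) : ℝ :=
  (M.ρ y z : ℝ) * Real.exp (⟪M.s y z, M.φ θ⟫ - M.ψ θ)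

/-- Incomplete likelihood `p(y; θ) = ∫ p(y, z; θ) μ(dz)`. -/
noncomputable def lik (M : Model n m d q Y Z) (y : Y) (θ : M.Θ) : ℝ :=
  ∫ z, M.completeLik y z θ ∂M.μ

/-- Conditional density `p(z | y; θ) = p(y, z; θ) / p(y; θ)` of the latent variable. -/
noncomputable def condDensity (M : Model n m d q Y Z) (y : Y) (z : Z) (θ : M.Θ) : ℝ :=
  M.completeLik y z θ / M.lik y θ

/-- Local loss `-m⁻¹ ∑ⱼ log p(y_{ij}; θ)` of worker `i`. -/
noncomputable def loss (M : Model n m d q Y Z) (i : Fin n) (θ : M.Θ) : ℝ :=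
  -((m : ℝ)⁻¹ * ∑ j, Real.log (M.lik (M.y i j) θ))

/-- Negative penalized normalized log-likelihood. -/
noncomputable def F (M : Model n m d q Y Z) (θ : M.Θ) : ℝ :=
  (n : ℝ)⁻¹ * ∑ i, M.loss i θ + M.R θ

/-- Conditional expectation `s̄_{ij}(θ)` of the complete-data sufficient statistics. -/
noncomputable def sbar (M : Model n m d q Y Z) (i : Fin n) (j : Fin m) (θ : M.Θ) : Vec q :=
  ∫ z, M.condDensity (M.y i j) z θ • M.s (M.y i j) z ∂M.μ

/-- Regularity of the model: convex open parameter set, measurable functions, and finite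
log-likelihoods, that is, `0 < p(y_{ij}; θ) < ∞`. -/
structure Regular (M : Model n m d q Y Z) : Prop where
  convex : Convex ℝ M.Θ
  isOpen : IsOpen M.Θ
  measurable_R : Measurable M.R
  measurable_φ : Measurable M.φ
  measurable_ψ : Measurable M.ψ
  measurable_ρ : ∀ i j, Measurable (M.ρ (M.y i j))
  measurable_s : ∀ i j, Measurable (M.s (M.y i j))
  lik_finite : ∀ i j θ, Integrable (fun z => M.completeLik (M.y i j) z θ) M.μ
  lik_pos : ∀ i j θ, 0 < M.lik (M.y i j) θ

/-- The conditional expectations `s̄_{ij}(θ)` (hence their averages over `j`) are well defined. -/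
def StatWellDefined (M : Model n m d q Y Z) : Prop :=
  ∀ i j θ, Integrable (fun z => M.condDensity (M.y i j) z θ • M.s (M.y i j) z) M.μ

/-- For every `s`, the function `θ ↦ ψ(θ) + R(θ) - ⟨s, φ(θ)⟩` has exactly one minimizer
on `Θ`. -/
def UniqueMStep (M : Model n m d q Y Z) : Prop :=
  ∀ s : Vec q, ∃! θ : M.Θ, ∀ θ' : M.Θ,
    M.ψ θ + M.R θ - ⟪s, M.φ θ⟫ ≤ M.ψ θ' + M.R θ' - ⟪s, M.φ θ'⟫

/-- The M-step map `T`: `T(s)` is the minimizer of `θ ↦ ψ(θ) + R(θ) - ⟨s, φ(θ)⟩` on `Θ`. -/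
noncomputable def T (M : Model n m d q Y Z) (hT : M.UniqueMStep) (s : Vec q) : M.Θ :=
  (hT s).exists.choose

/-- The map `s̄_{ij} ∘ T` on the expectation space. -/
noncomputable def sbarT (M : Model n m d q Y Z) (hT : M.UniqueMStep) (i : Fin n) (j : Fin m)
    (s : Vec q) : Vec q :=
  M.sbar i j (M.T hT s)

/-- Local mean field `h_i(s) = m⁻¹ ∑ⱼ s̄_{ij}(T(s)) - s`. -/
noncomputable def hLoc (M : Model n m d q Y Z) (hT : M.UniqueMStep) (i : Fin n) (s : Vec q) :
    Vec q :=
  (m : ℝ)⁻¹ • ∑ j, M.sbarT hT i j s - s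

/-- Mean field `h = n⁻¹ ∑ᵢ h_i`. -/
noncomputable def h (M : Model n m d q Y Z) (hT : M.UniqueMStep) (s : Vec q) : Vec q :=
  (n : ℝ)⁻¹ • ∑ i, M.hLoc hT i s

/-- The Lyapunov function `W = F ∘ T`. -/
noncomputable def W (M : Model n m d q Y Z) (hT : M.UniqueMStep) (s : Vec q) : ℝ :=
  M.F (M.T hT s)

/-- `W` is continuously differentiable, its gradient is globally Lipschitz with constant `LW`, and
`∇W(s) = -B(s) h(s)` for a positive definite matrix `B(s)` with spectrum in `[vmin, vmax]`. -/
structure Lyapunov (M : Model n m d q Y Z) (hT : M.UniqueMStep) (LW vmin vmax : ℝ) : Prop where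
  contDiff : ContDiff ℝ 1 (M.W hT)
  LW_pos : 0 < LW
  lipschitz : ∀ s s' : Vec q,
    ‖gradient (M.W hT) s - gradient (M.W hT) s'‖ ≤ LW * ‖s - s'‖
  vmin_pos : 0 < vmin
  vmin_le_vmax : vmin ≤ vmax
  exists_matrix : ∃ B : Vec q → Matrix (Fin q) (Fin q) ℝ, ∀ s,
    (B s).PosDef ∧ spectrum ℝ (B s) ⊆ Set.Icc vmin vmax ∧
      gradient (M.W hT) s = -(Matrix.toEuclideanLin (B s) (M.h hT s))

/-- The maps `s ↦ s̄_{ij}(T(s)) - s` are globally Lipschitz with constants `Lip i j`. -/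
def LipschitzStats (M : Model n m d q Y Z) (hT : M.UniqueMStep) (Lip : Fin n → Fin m → ℝ) :
    Prop :=
  ∀ i j (s s' : Vec q),
    ‖(M.sbarT hT i j s - s) - (M.sbarT hT i j s' - s')‖ ≤ Lip i j * ‖s - s'‖

end Model

/-! ## Compression and mini-batches -/

/-- A random compression operator `Quant(s) = Q ξ s`, with `ξ` of law `ν`, which is unbiased and
satisfies `E ‖Quant(s)‖² ≤ (1 + ω) ‖s‖²`. -/
structure IsCompressor {q : ℕ} {Ξ : Type*} [MeasurableSpace Ξ] (ν : Measure Ξ)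
    (Q : Ξ → Vec q → Vec q) (ω : ℝ) : Prop where
  omega_nonneg : 0 ≤ ω
  measurable : Measurable (Function.uncurry Q)
  integrable : ∀ s, Integrable (fun ξ => Q ξ s) ν
  unbiased : ∀ s, ∫ ξ, Q ξ s ∂ν = s
  integrable_sq : ∀ s, Integrable (fun ξ => ‖Q ξ s‖ ^ 2) ν
  second_moment : ∀ s, ∫ ξ, ‖Q ξ s‖ ^ 2 ∂ν ≤ (1 + ω) * ‖s‖ ^ 2

/-- The two ways of drawing a mini-batch. -/
inductive Sampling
  | withReplacement
  | withoutReplacement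

/-- The law of a mini-batch of size `b` from `m` examples, listed in the order of drawing: uniform
on all `b`-tuples (with replacement), or on all `b`-tuples of distinct indices (without
replacement). -/
noncomputable def batchLaw (b m : ℕ) : Sampling → Measure (Fin b → Fin m)
  | .withReplacement => uniformOn Set.univ
  | .withoutReplacement => uniformOn {B | Function.Injective B}

/-! ## The algorithm -/

/-- The variables of the algorithm after iteration `(t, k)`. -/
structure State (n q : ℕ) where
  /-- current iterate `Ŝ_{t,k}` -/
  S : Vec q
  /-- previous iterate `Ŝ_{t,k-1}` -/
  Sprev : Vec q
  /-- local statistics `S_{t,k,i}` -/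
  Sloc : Fin n → Vec q
  /-- local memories `V_{t,k,i}` -/
  Vloc : Fin n → Vec q
  /-- memory `V_{t,k}` of the server -/
  V : Vec q
  /-- field `H_{t,k}` -/
  H : Vec q

section Algorithm

variable {n m q b : ℕ} {Ξ : Type*}

/-- Local statistics of the workers, initialized with a full pass over the data; here and below,
`g i j` is the map `s̄_{ij} ∘ T`. -/
noncomputable def fullPass (g : Fin n → Fin m → Vec q → Vec q) (s : Vec q) (i : Fin n) : Vec q :=
  (m : ℝ)⁻¹ • ∑ j, g i j s

/-- State of the algorithm before its first iteration. -/
noncomputable def initState (g : Fin n → Fin m → Vec q → Vec q) (Sinit : Vec q)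
    (V0 : Fin n → Vec q) : State n q where
  S := Sinit
  Sprev := Sinit
  Sloc := fullPass g Sinit
  Vloc := V0
  V := (n : ℝ)⁻¹ • ∑ i, V0 i
  H := 0

/-- Start of a new outer loop from the final state of the previous one. -/
noncomputable def restart (g : Fin n → Fin m → Vec q → Vec q) (σ : State n q) : State n q where
  S := σ.S
  Sprev := σ.S
  Sloc := fullPass g σ.S
  Vloc := σ.Vloc
  V := σ.V
  H := 0

/-- Updated local statistics `S_{t,k+1,i}`, from the mini-batches `B i`. -/
noncomputable def nextSloc (g : Fin n → Fin m → Vec q → Vec q) (B : Fin n → Fin b → Fin m)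
    (σ : State n q) (i : Fin n) : Vec q :=
  σ.Sloc i + (b : ℝ)⁻¹ • ∑ l, (g i (B i l) σ.S - g i (B i l) σ.Sprev)

/-- The compressed vector `Quant(Δ_{t,k+1,i})` that worker `i` sends, where
`Δ_{t,k+1,i} = S_{t,k+1,i} - Ŝ_{t,k} - V_{t,k,i}`. -/
noncomputable def message (g : Fin n → Fin m → Vec q → Vec q) (Q : Ξ → Vec q → Vec q)
    (B : Fin n → Fin b → Fin m) (ξ : Fin n → Ξ) (σ : State n q) (i : Fin n) : Vec q :=
  Q (ξ i) (nextSloc g B σ i - σ.S - σ.Vloc i)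

/-- The field `H_{t,k+1} = V_{t,k} + n⁻¹ ∑ᵢ Quant(Δ_{t,k+1,i})`. -/
noncomputable def nextH (g : Fin n → Fin m → Vec q → Vec q) (Q : Ξ → Vec q → Vec q)
    (B : Fin n → Fin b → Fin m) (ξ : Fin n → Ξ) (σ : State n q) : Vec q :=
  σ.V + (n : ℝ)⁻¹ • ∑ i, message g Q B ξ σ i

/-- One inner iteration, with step size `γ`, mini-batches `B i` and quantization noises `ξ i`. -/
noncomputable def step (g : Fin n → Fin m → Vec q → Vec q) (Q : Ξ → Vec q → Vec q)
    (α γ : ℝ) (B : Fin n → Fin b → Fin m) (ξ : Fin n → Ξ) (σ : State n q) : State n q where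
  S := σ.S + γ • nextH g Q B ξ σ
  Sprev := σ.S
  Sloc := nextSloc g B σ
  Vloc := fun i => σ.Vloc i + α • message g Q B ξ σ i
  V := σ.V + α • ((n : ℝ)⁻¹ • ∑ i, message g Q B ξ σ i)
  H := nextH g Q B ξ σ

/-- `k` inner iterations from the state `σ`; iteration `k + 1` uses `γ (k + 1)`, `B k`, `ξ k`. -/
noncomputable def inner (g : Fin n → Fin m → Vec q → Vec q) (Q : Ξ → Vec q → Vec q)
    (α : ℝ) (γ : ℕ → ℝ) (B : ℕ → Fin n → Fin b → Fin m) (ξ : ℕ → Fin n → Ξ) (σ : State n q) :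
    ℕ → State n q
  | 0 => σ
  | k + 1 => step g Q α (γ (k + 1)) (B k) (ξ k) (inner g Q α γ B ξ σ k)

/-- State at the start of outer loop `t`; the outer loops are numbered from `0`. -/
noncomputable def outer (g : Fin n → Fin m → Vec q → Vec q) (Q : Ξ → Vec q → Vec q)
    (α : ℝ) (γ : ℕ → ℕ → ℝ) (kin : ℕ) (Sinit : Vec q) (V0 : Fin n → Vec q)
    (B : ℕ → ℕ → Fin n → Fin b → Fin m) (ξ : ℕ → ℕ → Fin n → Ξ) : ℕ → State n q
  | 0 => initState g Sinit V0
  | t + 1 => restart g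
      (inner g Q α (γ t) (B t) (ξ t) (outer g Q α γ kin Sinit V0 B ξ t) kin)

/-- State of the algorithm after `k` inner iterations of outer loop `t`; the outer loops are
numbered from `0`. -/
noncomputable def run (g : Fin n → Fin m → Vec q → Vec q) (Q : Ξ → Vec q → Vec q)
    (α : ℝ) (γ : ℕ → ℕ → ℝ) (kin : ℕ) (Sinit : Vec q) (V0 : Fin n → Vec q)
    (B : ℕ → ℕ → Fin n → Fin b → Fin m) (ξ : ℕ → ℕ → Fin n → Ξ) (t k : ℕ) : State n q :=
  inner g Q α (γ t) (B t) (ξ t) (outer g Q α γ kin Sinit V0 B ξ t) k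

end Algorithm

/-! ## The randomness of the algorithm -/

/-- The sources of randomness: the initial point, and the mini-batch and the quantization noise of
each worker at each iteration. -/
inductive Source (kout kin n : ℕ)
  | init
  | batch (t : Fin kout) (k : Fin kin) (i : Fin n)
  | quant (t : Fin kout) (k : Fin kin) (i : Fin n)

/-- The σ-algebra generated by a source of randomness. -/
@[reducible] def sourceSigma {n m q b : ℕ} {Ω Ξ : Type*} [MeasurableSpace Ξ] (kout kin : ℕ)
    (Sinit : Ω → Vec q) (B : ℕ → ℕ → Fin n → Ω → Fin b → Fin m) (ξ : ℕ → ℕ → Fin n → Ω → Ξ) :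
    Source kout kin n → MeasurableSpace Ω
  | .init => MeasurableSpace.comap Sinit inferInstance
  | .batch t k i => MeasurableSpace.comap (B t k i) inferInstance
  | .quant t k i => MeasurableSpace.comap (ξ t k i) inferInstance

/-- The mini-batches `B t k i` are drawn according to the scheme `sch`, the quantization noises
`ξ t k i` have law `ν`, and all of them and the initial point are mutually independent. -/
structure IsRandomInput {n m q b : ℕ} {Ω Ξ : Type*} [MeasurableSpace Ω] [MeasurableSpace Ξ]
    (P : Measure Ω) (ν : Measure Ξ) (sch : Sampling) (kout kin : ℕ)
    (Sinit : Ω → Vec q) (B : ℕ → ℕ → Fin n → Ω → Fin b → Fin m)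
    (ξ : ℕ → ℕ → Fin n → Ω → Ξ) : Prop where
  measurable_init : Measurable Sinit
  measurable_batch : ∀ (t : Fin kout) (k : Fin kin) i, Measurable (B t k i)
  measurable_quant : ∀ (t : Fin kout) (k : Fin kin) i, Measurable (ξ t k i)
  law_batch : ∀ (t : Fin kout) (k : Fin kin) i, P.map (B t k i) = batchLaw b m sch
  law_quant : ∀ (t : Fin kout) (k : Fin kin) i, P.map (ξ t k i) = ν
  indep : iIndep (sourceSigma kout kin Sinit B ξ) P

/-! ## The constants -/

/-- The constant `L ≥ 0` with `L² = n⁻¹ m⁻¹ ∑ᵢ ∑ⱼ L_{ij}²`. -/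
noncomputable def meanLip {n m : ℕ} (Lip : Fin n → Fin m → ℝ) : ℝ :=
  Real.sqrt ((n : ℝ)⁻¹ * (m : ℝ)⁻¹ * ∑ i, ∑ j, Lip i j ^ 2)

/-- The batch size `⌈k_in / (1 + ω)²⌉`. -/
noncomputable def batchSize (kin : ℕ) (ω : ℝ) : ℕ := ⌈(kin : ℝ) / (1 + ω) ^ 2⌉₊

/-- The constant step size. -/
noncomputable def stepSize (n : ℕ) (vmin vmax LW L ω : ℝ) : ℝ :=
  vmin / LW * (1 + 4 * Real.sqrt 2 * (vmax / LW) * (L / Real.sqrt n) * (1 + ω) *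
    Real.sqrt (ω + (1 + 10 * ω) / 8))⁻¹

end VRFedEM

/-! # Convergence of federated EM with variance reduction and compression

Write `S_k` for the iterates of an outer loop, `ē_k` for the average over the workers of the errors
of their local statistics, which estimate a full pass at `S_{k-1}`, and `h` for the mean field. Then
`H_{k+1} = h(S_k) + ē_{k+1} + (compression error)`. Two facts about the errors carry the proof.

* The errors `ē_k` are sums of independent centred mini-batch increments, hence
  `E‖ē_{k+1}‖² ≤ ‖ē_k‖² + L² / (n b) ‖S_k - S_{k-1}‖²` given the past, for both sampling schemes:
  draws without replacement are negatively correlated (`sum_batches_inner_nonpos`). The size `b` of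
  the mini-batches makes the accumulated error of an outer loop at most
  `γ² L² (1 + ω)² / n` times the sum of the `E‖H‖²`.
* The memory of a worker moves by `1 / (1 + ω)` times the compressed residual, so the mean square of
  its gap to the local field that it tracks contracts by the factor `ω / (1 + ω)`
  (`IsCompressor.integral_norm_sub_alpha_sq_le`), up to the square of the last move. Thus the
  compression errors are controlled by the past moves `γ • H` as well.

For `∇W = -B h` with `v_min ≤ B ≤ v_max`, the descent lemma and Young's inequality for the form
`⟪B x, y⟫` give `W(S + γ H) ≤ W(S) - (γ v_min - …) ‖H‖² + (v_max / (2 C)) ‖H - h(S)‖²`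
(`Model.Lyapunov.descent`). Adding to `W - inf W` the potentials `errPot` and `memPot` of the two
errors, one obtains a quantity whose expectation decreases by a multiple of `E‖H‖²` per iteration
(`lintegral_potential_step_le`) and does not increase at the restarts (`memPot_restart_le`). As `C`
decreases to `errRatio`, the multiple tends to `γ v_min / 2`, which is how the step size is chosen.
Summing and averaging over the uniform index gives the first bound.

For the second bound, given the mini-batches, `H_{k+1}` is unbiased for `h(S_k) + ē_{k+1}`, so
`‖h(S_k)‖² ≤ 2 E‖H_{k+1}‖² + 2 E‖ē_{k+1}‖²`, and the accumulated errors are bounded as above.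

The one-step inequalities are proved for a deterministic state and transferred to the path by
independence of the fresh noise from the past (`IsRandomInput.lintegral_path_succ`). There they
are inequalities between Lebesgue integrals in `[0, ∞]`, so that the integrability of `‖H‖²` and
`‖h‖²` is a consequence of the bounds.
-/

namespace VRFedEM

/-! ### Smooth functions and symmetric matrices -/

/-- The descent lemma. -/
theorem le_add_inner_gradient_add_sq {E : Type*} [NormedAddCommGroup E] [InnerProductSpace ℝ E]
    [CompleteSpace E] {f : E → ℝ} {L : ℝ} (hf : ContDiff ℝ 1 f)
    (hL : ∀ s s' : E, ‖gradient f s - gradient f s'‖ ≤ L * ‖s - s'‖) (s v : E) :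
    f (s + v) ≤ f s + ⟪gradient f s, v⟫ + L / 2 * ‖v‖ ^ 2 := by
  have hd : Differentiable ℝ f := hf.differentiable (by simp)
  have hderiv : ∀ t : ℝ, HasDerivAt
      (fun t : ℝ => f (s + t • v) - t * ⟪gradient f s, v⟫ - L / 2 * t ^ 2 * ‖v‖ ^ 2)
      (⟪gradient f (s + t • v), v⟫ - ⟪gradient f s, v⟫ - L * t * ‖v‖ ^ 2) t := by
    intro t
    have h1 : HasDerivAt (fun t : ℝ => s + t • v) v t := by
      simpa using ((hasDerivAt_id t).smul_const v).const_add s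
    have h2 := (hd (s + t • v)).hasGradientAt.hasFDerivAt.comp_hasDerivAt t h1
    have h3 : HasDerivAt (fun t : ℝ => t * ⟪gradient f s, v⟫) ⟪gradient f s, v⟫ t := by
      simpa using (hasDerivAt_id t).mul_const ⟪gradient f s, v⟫
    have h4 : HasDerivAt (fun t : ℝ => L / 2 * t ^ 2 * ‖v‖ ^ 2) (L * t * ‖v‖ ^ 2) t := by
      have := (((hasDerivAt_id t).pow 2).const_mul (L / 2)).mul_const (‖v‖ ^ 2)
      refine this.congr_deriv ?_
      simp only [id]
      push_cast
      ring
    exact ((h2.congr_deriv (by simp)).sub h3).sub h4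
  have hanti : AntitoneOn
      (fun t : ℝ => f (s + t • v) - t * ⟪gradient f s, v⟫ - L / 2 * t ^ 2 * ‖v‖ ^ 2)
      (Set.Ici 0) := by
    refine antitoneOn_of_deriv_nonpos (convex_Ici 0)
      (fun t _ => (hderiv t).continuousAt.continuousWithinAt)
      (fun t _ => (hderiv t).differentiableAt.differentiableWithinAt) fun t ht => ?_
    rw [interior_Ici] at ht
    have ht : 0 < t := ht
    rw [(hderiv t).deriv]
    have h1 : ⟪gradient f (s + t • v), v⟫ - ⟪gradient f s, v⟫ ≤ L * t * ‖v‖ * ‖v‖ := by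
      rw [← inner_sub_left]
      refine (real_inner_le_norm _ _).trans ?_
      gcongr
      refine (hL _ _).trans (le_of_eq ?_)
      rw [add_sub_cancel_left, norm_smul, Real.norm_of_nonneg ht.le, mul_assoc]
    nlinarith
  have := hanti (Set.mem_Ici.2 le_rfl) (Set.mem_Ici.2 zero_le_one) zero_le_one
  simp only [zero_smul, one_smul, add_zero] at this
  linarith

/-- For a symmetric matrix, `⟪B x, y⟫` is diagonal in the eigenvector basis. -/
theorem inner_toEuclideanLin_eq_sum {q : ℕ} {B : Matrix (Fin q) (Fin q) ℝ} (hB : B.IsHermitian)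
    (x y : Vec q) :
    ⟪Matrix.toEuclideanLin B x, y⟫ =
      ∑ i, hB.eigenvalues i * (⟪hB.eigenvectorBasis i, x⟫ * ⟪hB.eigenvectorBasis i, y⟫) := by
  have hsymm := (Matrix.isSymmetric_toEuclideanLin_iff (A := B)).2 hB
  rw [← hB.eigenvectorBasis.sum_inner_mul_inner]
  refine Finset.sum_congr rfl fun i _ => ?_
  rw [hsymm]
  have : Matrix.toEuclideanLin B (hB.eigenvectorBasis i) =
      hB.eigenvalues i • hB.eigenvectorBasis i := by
    ext j
    have := congrFun (hB.mulVec_eigenvectorBasis i) j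
    simpa [Matrix.toLpLin_apply] using this
  rw [this, inner_smul_right, real_inner_comm]
  ring

theorem mul_norm_sq_le_inner_toEuclideanLin {q : ℕ} {B : Matrix (Fin q) (Fin q) ℝ}
    (hB : B.IsHermitian) {vmin vmax : ℝ} (hspec : spectrum ℝ B ⊆ Set.Icc vmin vmax) (x : Vec q) :
    vmin * ‖x‖ ^ 2 ≤ ⟪Matrix.toEuclideanLin B x, x⟫ := by
  rw [inner_toEuclideanLin_eq_sum hB, ← hB.eigenvectorBasis.sum_sq_inner_right x, Finset.mul_sum]
  refine Finset.sum_le_sum fun i _ => ?_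
  rw [← sq]
  gcongr
  exact (hspec (hB.eigenvalues_mem_spectrum_real i)).1

/-- Young's inequality for the bilinear form of a symmetric matrix. -/
theorem inner_toEuclideanLin_le {q : ℕ} {B : Matrix (Fin q) (Fin q) ℝ}
    (hB : B.IsHermitian) {vmin vmax : ℝ} (hv : 0 ≤ vmin)
    (hspec : spectrum ℝ B ⊆ Set.Icc vmin vmax) (x y : Vec q) {c : ℝ} (hc : 0 < c) :
    ⟪Matrix.toEuclideanLin B x, y⟫ ≤ vmax / (2 * c) * ‖x‖ ^ 2 + vmax * c / 2 * ‖y‖ ^ 2 := by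
  rw [inner_toEuclideanLin_eq_sum hB, ← hB.eigenvectorBasis.sum_sq_inner_right x,
    ← hB.eigenvectorBasis.sum_sq_inner_right y, Finset.mul_sum, Finset.mul_sum,
    ← Finset.sum_add_distrib]
  refine Finset.sum_le_sum fun i _ => ?_
  obtain ⟨h1, h2⟩ := hspec (hB.eigenvalues_mem_spectrum_real i)
  set a := ⟪hB.eigenvectorBasis i, x⟫
  set b := ⟪hB.eigenvectorBasis i, y⟫
  have hyoung : a * b ≤ 1 / (2 * c) * a ^ 2 + c / 2 * b ^ 2 := by
    have : 0 ≤ (a - c * b) ^ 2 / (2 * c) := by positivity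
    have h3 : (a - c * b) ^ 2 / (2 * c) = 1 / (2 * c) * a ^ 2 + c / 2 * b ^ 2 - a * b := by
      field_simp
      ring
    linarith
  calc hB.eigenvalues i * (a * b)
      ≤ hB.eigenvalues i * (1 / (2 * c) * a ^ 2 + c / 2 * b ^ 2) := by gcongr; linarith
    _ ≤ vmax * (1 / (2 * c) * a ^ 2 + c / 2 * b ^ 2) := by gcongr
    _ = _ := by ring

/-! ### Sums of independent centred vectors -/

section Sums

variable {n : ℕ} {E : Type*} [NormedAddCommGroup E] [InnerProductSpace ℝ E] [CompleteSpace E]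
  [MeasurableSpace E] [BorelSpace E] [SecondCountableTopology E]
  {Ξ : Type*} [MeasurableSpace Ξ] (ν : Measure Ξ) [IsProbabilityMeasure ν]

omit [InnerProductSpace ℝ E] [CompleteSpace E] [MeasurableSpace E] [BorelSpace E]
  [SecondCountableTopology E] in
theorem memLp_two_comp_eval {f : Ξ → E} (hf : MemLp f 2 ν) (i : Fin n) :
    MemLp (fun x : Fin n → Ξ => f (x i)) 2 (Measure.pi fun _ => ν) :=
  hf.comp_measurePreserving (measurePreserving_eval (fun _ : Fin n => ν) i)

omit [CompleteSpace E] [MeasurableSpace E] [BorelSpace E] [SecondCountableTopology E] in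
theorem integrable_inner_of_memLp_two {α : Type*} {_ : MeasurableSpace α} {μ : Measure α}
    {f g : α → E} (hf : MemLp f 2 μ) (hg : MemLp g 2 μ) :
    Integrable (fun x => ⟪f x, g x⟫) μ := by
  refine (hf.norm.integrable_sq.add hg.norm.integrable_sq).mono' (hf.1.inner hg.1)
    (Filter.Eventually.of_forall fun x => ?_)
  have h1 := abs_real_inner_le_norm (f x) (g x)
  have h2 := sq_nonneg (‖f x‖ - ‖g x‖)
  simp only [Real.norm_eq_abs, Pi.add_apply]
  nlinarith [sq_nonneg (‖f x‖ + ‖g x‖)]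

theorem integral_comp_eval {F : Type*} [NormedAddCommGroup F] [NormedSpace ℝ F] {f : Ξ → F}
    (hf : AEStronglyMeasurable f ν) (i : Fin n) :
    ∫ x : Fin n → Ξ, f (x i) ∂(Measure.pi fun _ => ν) = ∫ x, f x ∂ν := by
  have h := (measurePreserving_eval (fun _ : Fin n => ν) i).map_eq
  rw [← h] at hf
  conv_rhs => rw [← h]
  exact (integral_map (measurable_pi_apply i).aemeasurable hf).symm

omit [SecondCountableTopology E] in
/-- Pythagoras: the variance of a sum of independent vectors is the sum of their variances. -/
theorem integral_norm_add_sum_sq (c : E) (f : Fin n → Ξ → E) (hf : ∀ i, MemLp (f i) 2 ν)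
    (h0 : ∀ i, ∫ x, f i x ∂ν = 0) :
    ∫ x : Fin n → Ξ, ‖c + ∑ i, f i (x i)‖ ^ 2 ∂(Measure.pi fun _ => ν) =
      ‖c‖ ^ 2 + ∑ i, ∫ x, ‖f i x‖ ^ 2 ∂ν := by
  set π : Measure (Fin n → Ξ) := Measure.pi fun _ => ν
  have hL2 : ∀ i, MemLp (fun x : Fin n → Ξ => f i (x i)) 2 π := fun i =>
    memLp_two_comp_eval ν (hf i) i
  have hint : ∀ i, Integrable (fun x : Fin n → Ξ => f i (x i)) π := fun i =>
    (hL2 i).integrable (by norm_num)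
  have hinner : ∀ i j, Integrable (fun x : Fin n → Ξ => ⟪f i (x i), f j (x j)⟫) π := fun i j =>
    integrable_inner_of_memLp_two (hL2 i) (hL2 j)
  have hmean : ∀ i, ∫ x : Fin n → Ξ, f i (x i) ∂π = 0 := fun i => by
    rw [integral_comp_eval ν (hf i).1, h0]
  have hcross : ∀ i j, i ≠ j → ∫ x : Fin n → Ξ, ⟪f i (x i), f j (x j)⟫ ∂π = 0 := by
    intro i j hij
    have hind : iIndepFun (fun (i : Fin n) (x : Fin n → Ξ) => f i (x i)) π :=
      iIndepFun_pi (X := f) fun i => (hf i).1.aemeasurable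
    have h := (hind.indepFun hij).integral_bilin (hint i) (hint j) (innerSL ℝ)
    rw [hmean i, map_zero, zero_apply] at h
    exact h
  have hexp : ∀ x : Fin n → Ξ, ‖c + ∑ i, f i (x i)‖ ^ 2 =
      ‖c‖ ^ 2 + 2 * ⟪c, ∑ i, f i (x i)⟫ + ∑ i, ∑ j, ⟪f i (x i), f j (x j)⟫ := by
    intro x
    rw [norm_add_sq_real, ← real_inner_self_eq_norm_sq (∑ i, f i (x i)), sum_inner]
    simp only [inner_sum]
  have hsum : Integrable (fun x : Fin n → Ξ => ∑ i, f i (x i)) π :=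
    integrable_finsetSum _ fun i _ => hint i
  have hI2 : Integrable (fun x : Fin n → Ξ => 2 * ⟪c, ∑ i, f i (x i)⟫) π :=
    (hsum.const_inner c).const_mul 2
  have hI12 : Integrable (fun x : Fin n → Ξ => ‖c‖ ^ 2 + 2 * ⟪c, ∑ i, f i (x i)⟫) π :=
    (integrable_const _).add hI2
  rw [integral_congr_ae (Filter.Eventually.of_forall hexp), integral_add hI12
      (integrable_finsetSum _ fun i _ => integrable_finsetSum _ fun j _ => hinner i j),
    integral_add (integrable_const _) hI2, integral_const_mul, integral_inner hsum,
    integral_finsetSum _ (fun i _ => hint i), integral_finsetSum _ (fun i _ =>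
      integrable_finsetSum _ fun j _ => hinner i j)]
  simp_rw [integral_finsetSum _ (fun j _ => hinner _ j), hmean]
  simp only [integral_const, probReal_univ, smul_eq_mul, one_mul, Finset.sum_const_zero,
    inner_zero_right, mul_zero, add_zero]
  congr 1
  refine Finset.sum_congr rfl fun i _ => ?_
  rw [Finset.sum_eq_single i (fun j _ hj => hcross i j hj.symm) (by simp)]
  simp_rw [real_inner_self_eq_norm_sq]
  exact integral_comp_eval ν ((hf i).norm.integrable_sq.1) i

end Sums

/-! ### Mini-batch sampling -/

theorem integral_uniformOn {α F : Type*} [Fintype α] [MeasurableSpace α]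
    [MeasurableSingletonClass α] [NormedAddCommGroup F] [NormedSpace ℝ F] [CompleteSpace F]
    (s : Finset α) (f : α → F) :
    ∫ x, f x ∂(uniformOn (s : Set α)) = (s.card : ℝ)⁻¹ • ∑ x ∈ s, f x := by
  classical
  rw [uniformOn, ProbabilityTheory.cond, integral_smul_measure, Measure.count_apply_finset,
    ← integral_indicator s.measurableSet, integral_count]
  congr 1
  · simp
  · simp [Set.indicator_apply, Finset.sum_ite_mem]

section Sampling

variable {b m : ℕ} {E : Type*} [NormedAddCommGroup E] [InnerProductSpace ℝ E]

/-- For a family of mini-batches which is invariant under relabellings of the examples, each draw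
of a uniform member is uniform. -/
theorem card_mul_sum_eval {F : Type*} [AddCommGroup F] [Module ℝ F]
    (𝓢 : Finset (Fin b → Fin m)) (h𝓢 : ∀ π : Equiv.Perm (Fin m), ∀ B ∈ 𝓢, π ∘ B ∈ 𝓢)
    (f : Fin m → F) (l : Fin b) :
    (m : ℝ) • ∑ B ∈ 𝓢, f (B l) = (𝓢.card : ℝ) • ∑ j, f j := by
  rcases Nat.eq_zero_or_pos m with rfl | hm
  · rw [Finset.sum_eq_zero (fun B _ => (B l).elim0)]
    simp
  have : NeZero m := ⟨hm.ne'⟩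
  have hshift : ∀ a : Fin m, ∑ B ∈ 𝓢, f (B l + a) = ∑ B ∈ 𝓢, f (B l) := fun a =>
    Finset.sum_bij' (fun B _ => Equiv.addRight a ∘ B) (fun B _ => (Equiv.addRight a).symm ∘ B)
      (fun B hB => h𝓢 _ B hB) (fun B hB => h𝓢 _ B hB) (fun B _ => by ext; simp)
      (fun B _ => by ext; simp) (fun B _ => by simp)
  have h1 : ∑ a : Fin m, ∑ B ∈ 𝓢, f (B l + a) = (m : ℝ) • ∑ B ∈ 𝓢, f (B l) := by
    simp [hshift, Nat.cast_smul_eq_nsmul]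
  rw [← h1, Finset.sum_comm]
  have h2 : ∀ B : Fin b → Fin m, ∑ a, f (B l + a) = ∑ j, f j := fun B =>
    Equiv.sum_comp (Equiv.addLeft (B l)) f
  simp [h2, Nat.cast_smul_eq_nsmul]

/-- Two distinct draws without replacement are negatively correlated: this holds on average over
the relabellings of the examples. -/
theorem sum_perm_inner_nonpos {c : Fin m → E} (hc : ∑ j, c j = 0) {j j' : Fin m} (hj : j ≠ j') :
    ∑ π : Equiv.Perm (Fin m), ⟪c (π j), c (π j')⟫ ≤ 0 := by
  have hsame : ∀ k ∈ Finset.univ.erase j,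
      ∑ π : Equiv.Perm (Fin m), ⟪c (π j), c (π k)⟫ =
        ∑ π : Equiv.Perm (Fin m), ⟪c (π j), c (π j')⟫ := by
    intro k hk
    have hk : k ≠ j := Finset.ne_of_mem_erase hk
    rw [← Equiv.sum_comp (Equiv.mulRight (Equiv.swap j' k))]
    refine Finset.sum_congr rfl fun π _ => ?_
    simp [Equiv.swap_apply_of_ne_of_ne hj hk.symm]
  have htot : ∑ k, ∑ π : Equiv.Perm (Fin m), ⟪c (π j), c (π k)⟫ = 0 := by
    rw [Finset.sum_comm]
    refine Finset.sum_eq_zero fun π _ => ?_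
    rw [← inner_sum, Equiv.sum_comp π c, hc, inner_zero_right]
  rw [← Finset.add_sum_erase _ _ (Finset.mem_univ j), Finset.sum_congr rfl hsame,
    Finset.sum_const, nsmul_eq_mul] at htot
  have hcard : (0 : ℝ) < ((Finset.univ.erase j).card : ℝ) :=
    Nat.cast_pos.2 (Finset.card_pos.2 ⟨j', Finset.mem_erase.2 ⟨hj.symm, Finset.mem_univ _⟩⟩)
  have hnn : 0 ≤ ∑ π : Equiv.Perm (Fin m), ⟪c (π j), c (π j)⟫ :=
    Finset.sum_nonneg fun π _ => real_inner_self_nonneg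
  by_contra hpos
  rw [not_le] at hpos
  have := mul_pos hcard hpos
  linarith

/-- The mini-batches that a sampling scheme may draw. -/
noncomputable def batches (b m : ℕ) : Sampling → Finset (Fin b → Fin m)
  | .withReplacement => Finset.univ
  | .withoutReplacement => {B : Fin b → Fin m | Function.Injective B}.toFinite.toFinset

theorem batchLaw_eq (b m : ℕ) (sch : Sampling) :
    batchLaw b m sch = uniformOn (batches b m sch : Set (Fin b → Fin m)) := by
  cases sch <;> simp [batchLaw, batches]

theorem comp_mem_batches (sch : Sampling) (π : Equiv.Perm (Fin m)) (B : Fin b → Fin m)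
    (hB : B ∈ batches b m sch) : π ∘ B ∈ batches b m sch := by
  cases sch
  · simp [batches]
  · simpa [batches] using hB

theorem sum_batches_inner_nonpos (sch : Sampling) {c : Fin m → E} (hc : ∑ j, c j = 0)
    {l l' : Fin b} (hl : l ≠ l') : ∑ B ∈ batches b m sch, ⟪c (B l), c (B l')⟫ ≤ 0 := by
  cases sch
  · -- with replacement, resample the draw `l` only
    rcases Nat.eq_zero_or_pos m with rfl | hm
    · exact (Finset.sum_eq_zero fun B _ => (B l).elim0).le
    have : NeZero m := ⟨hm.ne'⟩
    have hshift : ∀ a : Fin m, ∑ B : Fin b → Fin m, ⟪c (B l + a), c (B l')⟫ =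
        ∑ B : Fin b → Fin m, ⟪c (B l), c (B l')⟫ := fun a =>
      Finset.sum_bij' (fun B _ => Function.update B l (B l + a))
        (fun B _ => Function.update B l (B l - a)) (by simp) (by simp) (by simp) (by simp)
        (fun B _ => by simp [Function.update_of_ne hl.symm])
    have hc' : ∀ B : Fin b → Fin m, ∑ a, c (B l + a) = 0 := fun B =>
      (Equiv.sum_comp (Equiv.addLeft (B l)) c).trans hc
    have h1 : ∑ a : Fin m, ∑ B : Fin b → Fin m, ⟪c (B l + a), c (B l')⟫ = 0 := by
      rw [Finset.sum_comm]
      refine Finset.sum_eq_zero fun B _ => ?_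
      rw [← sum_inner, hc', inner_zero_left]
    simp only [hshift, Finset.sum_const, Finset.card_univ, Fintype.card_fin, nsmul_eq_mul] at h1
    exact ((mul_eq_zero.1 h1).resolve_left (by positivity)).le
  · set 𝓢 := batches b m .withoutReplacement
    have hperm : ∀ π : Equiv.Perm (Fin m), ∑ B ∈ 𝓢, ⟪c (π (B l)), c (π (B l'))⟫ =
        ∑ B ∈ 𝓢, ⟪c (B l), c (B l')⟫ := fun π =>
      Finset.sum_bij' (fun B _ => π ∘ B) (fun B _ => π.symm ∘ B)
        (fun B hB => comp_mem_batches _ _ B hB) (fun B hB => comp_mem_batches _ _ B hB)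
        (fun B _ => by ext; simp) (fun B _ => by ext; simp) (fun B _ => by simp)
    have h1 : ∑ π : Equiv.Perm (Fin m), ∑ B ∈ 𝓢, ⟪c (π (B l)), c (π (B l'))⟫ ≤ 0 := by
      rw [Finset.sum_comm]
      refine Finset.sum_nonpos fun B hB => sum_perm_inner_nonpos hc fun h => hl ?_
      have hB : Function.Injective B := by simpa [𝓢, batches] using hB
      exact hB h
    simp only [hperm, Finset.sum_const, nsmul_eq_mul] at h1
    have hcard : (0 : ℝ) < ((Finset.univ : Finset (Equiv.Perm (Fin m))).card : ℝ) :=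
      Nat.cast_pos.2 (Finset.card_pos.2 ⟨1, Finset.mem_univ _⟩)
    exact nonpos_of_mul_nonpos_right h1 hcard

variable [CompleteSpace E]

/-- A mini-batch mean is unbiased. -/
theorem integral_batch_mean (hb : 0 < b) (hm : 0 < m) (sch : Sampling)
    [IsProbabilityMeasure (batchLaw b m sch)] (a : Fin m → E) :
    ∫ B : Fin b → Fin m, (b : ℝ)⁻¹ • ∑ l, a (B l) ∂(batchLaw b m sch) =
      (m : ℝ)⁻¹ • ∑ j, a j := by
  have hne : (batches b m sch).card ≠ 0 := by
    intro h0
    have h := (inferInstance : IsProbabilityMeasure (batchLaw b m sch)).measure_univ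
    rw [batchLaw_eq, Finset.card_eq_zero.1 h0] at h
    simp at h
  have hb' : (b : ℝ) ≠ 0 := by positivity
  have hm' : (m : ℝ) ≠ 0 := by positivity
  have hc' : ((batches b m sch).card : ℝ) ≠ 0 := Nat.cast_ne_zero.2 hne
  have hl : ∀ l : Fin b, ∑ B ∈ batches b m sch, a (B l) =
      ((m : ℝ)⁻¹ * (batches b m sch).card) • ∑ j, a j := fun l => by
    rw [mul_smul, ← card_mul_sum_eval _ (comp_mem_batches sch) a l, inv_smul_smul₀ hm']
  rw [batchLaw_eq, integral_uniformOn, ← Finset.smul_sum, Finset.sum_comm]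
  simp only [hl, Finset.sum_const, Finset.card_univ, Fintype.card_fin]
  rw [← Nat.cast_smul_eq_nsmul ℝ, smul_smul, smul_smul, smul_smul]
  congr 1
  field_simp

omit [CompleteSpace E] in
/-- The second moment of a centred mini-batch mean is at most the population variance divided by
the size of the batch. -/
theorem integral_batch_mean_sq_le (hb : 0 < b) (hm : 0 < m) (sch : Sampling)
    [IsProbabilityMeasure (batchLaw b m sch)] {c : Fin m → E} (hc : ∑ j, c j = 0) :
    ∫ B : Fin b → Fin m, ‖(b : ℝ)⁻¹ • ∑ l, c (B l)‖ ^ 2 ∂(batchLaw b m sch) ≤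
      (b : ℝ)⁻¹ * ((m : ℝ)⁻¹ * ∑ j, ‖c j‖ ^ 2) := by
  have hb' : (b : ℝ) ≠ 0 := by positivity
  have hexp : ∀ B : Fin b → Fin m, ‖(b : ℝ)⁻¹ • ∑ l, c (B l)‖ ^ 2 =
      (b : ℝ)⁻¹ ^ 2 * ∑ l, ∑ l', ⟪c (B l), c (B l')⟫ := by
    intro B
    rw [norm_smul, mul_pow, ← real_inner_self_eq_norm_sq (∑ l, c (B l)), sum_inner]
    simp only [inner_sum]
    simp
  have hmean := integral_batch_mean hb hm sch fun j => ‖c j‖ ^ 2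
  rw [batchLaw_eq, integral_uniformOn] at hmean ⊢
  simp only [hexp, smul_eq_mul] at hmean ⊢
  rw [← hmean, mul_left_comm]
  gcongr
  have hcross : ∑ B ∈ batches b m sch, ∑ l, ∑ l', ⟪c (B l), c (B l')⟫ ≤
      ∑ B ∈ batches b m sch, ∑ l, ‖c (B l)‖ ^ 2 := by
    rw [Finset.sum_comm, Finset.sum_comm (s := batches b m sch)]
    refine Finset.sum_le_sum fun l _ => ?_
    rw [Finset.sum_comm, ← Finset.add_sum_erase _ _ (Finset.mem_univ l)]
    simp only [real_inner_self_eq_norm_sq]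
    have : ∑ l' ∈ Finset.univ.erase l, ∑ B ∈ batches b m sch, ⟪c (B l), c (B l')⟫ ≤ 0 :=
      Finset.sum_nonpos fun l' hl' =>
        sum_batches_inner_nonpos sch hc (Finset.ne_of_mem_erase hl').symm
    linarith
  rw [← Finset.mul_sum, ← Finset.mul_sum, sq, mul_assoc]
  gcongr

end Sampling

/-! ### Mini-batch increments of a worker -/

section Increments

variable {b m : ℕ} {E : Type*} [NormedAddCommGroup E] [InnerProductSpace ℝ E]

theorem norm_inv_smul_sum_sq_le (hb : 0 < b) (v : Fin b → E) :
    ‖(b : ℝ)⁻¹ • ∑ l, v l‖ ^ 2 ≤ (b : ℝ)⁻¹ * ∑ l, ‖v l‖ ^ 2 := by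
  have hb' : (0 : ℝ) < b := by positivity
  have h1 : ‖∑ l, v l‖ ^ 2 ≤ b * ∑ l, ‖v l‖ ^ 2 := by
    calc ‖∑ l, v l‖ ^ 2 ≤ (∑ l, ‖v l‖) ^ 2 := by gcongr; exact norm_sum_le _ _
      _ ≤ (Finset.univ : Finset (Fin b)).card * ∑ l, ‖v l‖ ^ 2 := sq_sum_le_card_mul_sum_sq
      _ = b * ∑ l, ‖v l‖ ^ 2 := by simp
  rw [norm_smul, mul_pow, norm_inv, Real.norm_of_nonneg hb'.le]
  calc ((b : ℝ)⁻¹) ^ 2 * ‖∑ l, v l‖ ^ 2 ≤ ((b : ℝ)⁻¹) ^ 2 * (b * ∑ l, ‖v l‖ ^ 2) := by gcongr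
    _ = _ := by field_simp

/-- The deviation of the vectors `a j` from their mean. -/
noncomputable def centered (a : Fin m → E) (j : Fin m) : E := a j - (m : ℝ)⁻¹ • ∑ k, a k

theorem sum_centered (hm : 0 < m) (a : Fin m → E) : ∑ j, centered a j = 0 := by
  have hm' : (m : ℝ) ≠ 0 := by positivity
  simp [centered, Finset.sum_sub_distrib, ← Nat.cast_smul_eq_nsmul ℝ, smul_smul, hm']

theorem sum_norm_centered_sq_le (hm : 0 < m) (a : Fin m → E) :
    ∑ j, ‖centered a j‖ ^ 2 ≤ ∑ j, ‖a j‖ ^ 2 := by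
  set c := (m : ℝ)⁻¹ • ∑ k, a k with hc
  have h : ∀ j, ‖a j‖ ^ 2 = ‖centered a j‖ ^ 2 + 2 * ⟪centered a j, c⟫ + ‖c‖ ^ 2 := fun j => by
    rw [← norm_add_sq_real]
    simp [centered, hc]
  simp only [h, Finset.sum_add_distrib, ← Finset.mul_sum, ← sum_inner, sum_centered hm,
    inner_zero_left, mul_zero, add_zero]
  exact le_add_of_nonneg_right (Finset.sum_nonneg fun _ _ => sq_nonneg _)

variable [CompleteSpace E]

theorem integral_norm_add_sq {α : Type*} [MeasurableSpace α] {μ : Measure α}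
    [IsProbabilityMeasure μ] (c : E) {f : α → E} (hf : MemLp f 2 μ) (h0 : ∫ x, f x ∂μ = 0) :
    ∫ x, ‖c + f x‖ ^ 2 ∂μ = ‖c‖ ^ 2 + ∫ x, ‖f x‖ ^ 2 ∂μ := by
  have hint := hf.integrable (by norm_num : (1 : ENNReal) ≤ 2)
  have hI2 : Integrable (fun x => 2 * ⟪c, f x⟫) μ := (hint.const_inner c).const_mul 2
  have hI : Integrable (fun x => ‖c‖ ^ 2 + 2 * ⟪c, f x⟫) μ := (integrable_const _).add hI2
  simp only [norm_add_sq_real]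
  rw [integral_add hI hf.norm.integrable_sq, integral_add (integrable_const _) hI2,
    integral_const_mul, integral_inner hint, h0]
  simp

variable (hb : 0 < b) (hm : 0 < m) (sch : Sampling) [IsProbabilityMeasure (batchLaw b m sch)]
include hb hm

theorem integral_batch_centered (a : Fin m → E) :
    ∫ B : Fin b → Fin m, (b : ℝ)⁻¹ • ∑ l, centered a (B l) ∂(batchLaw b m sch) = 0 := by
  rw [integral_batch_mean hb hm, sum_centered hm, smul_zero]

omit [CompleteSpace E] in
theorem integral_batch_centered_sq_le (a : Fin m → E) :
    ∫ B : Fin b → Fin m, ‖(b : ℝ)⁻¹ • ∑ l, centered a (B l)‖ ^ 2 ∂(batchLaw b m sch) ≤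
      (b : ℝ)⁻¹ * ((m : ℝ)⁻¹ * ∑ j, ‖a j‖ ^ 2) := by
  refine (integral_batch_mean_sq_le hb hm sch (sum_centered hm a)).trans ?_
  gcongr (b : ℝ)⁻¹ * ((m : ℝ)⁻¹ * ?_)
  exact sum_norm_centered_sq_le hm a

omit [CompleteSpace E] in
theorem integral_batch_sq_le (a : Fin m → E) :
    ∫ B : Fin b → Fin m, ‖(b : ℝ)⁻¹ • ∑ l, a (B l)‖ ^ 2 ∂(batchLaw b m sch) ≤
      (m : ℝ)⁻¹ * ∑ j, ‖a j‖ ^ 2 := by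
  have h := integral_batch_mean hb hm sch fun j => ‖a j‖ ^ 2
  simp only [smul_eq_mul] at h
  rw [← h]
  exact integral_mono .of_finite .of_finite fun B => norm_inv_smul_sum_sq_le hb _

end Increments

/-! ### Compression -/

section Compression

variable {n q : ℕ} {Ξ : Type*} [MeasurableSpace Ξ] {ν : Measure Ξ} [IsProbabilityMeasure ν]
  {Q : Ξ → Vec q → Vec q} {ω : ℝ} (hQ : IsCompressor ν Q ω)
include hQ

omit [IsProbabilityMeasure ν] in
theorem IsCompressor.memLp (s : Vec q) : MemLp (fun ξ => Q ξ s) 2 ν :=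
  (memLp_two_iff_integrable_sq_norm (hQ.integrable s).1).2 (hQ.integrable_sq s)

theorem IsCompressor.memLp_sub (s : Vec q) : MemLp (fun ξ => Q ξ s - s) 2 ν :=
  (hQ.memLp s).sub (memLp_const s)

theorem IsCompressor.integral_sub_self (s : Vec q) : ∫ ξ, (Q ξ s - s) ∂ν = 0 := by
  rw [integral_sub (hQ.integrable s) (integrable_const s), hQ.unbiased]
  simp

theorem IsCompressor.integral_norm_sub_smul_sq_le (s : Vec q) (β : ℝ) :
    ∫ ξ, ‖s - β • Q ξ s‖ ^ 2 ∂ν ≤ (1 - 2 * β + β ^ 2 * (1 + ω)) * ‖s‖ ^ 2 := by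
  have h1 : Integrable (fun ξ => 2 * (β * ⟪s, Q ξ s⟫)) ν :=
    (((hQ.integrable s).const_inner s).const_mul β).const_mul 2
  have h2 : Integrable (fun ξ => ‖s‖ ^ 2 - 2 * (β * ⟪s, Q ξ s⟫)) ν := (integrable_const _).sub h1
  have hexp : ∀ ξ, ‖s - β • Q ξ s‖ ^ 2 =
      ‖s‖ ^ 2 - 2 * (β * ⟪s, Q ξ s⟫) + β ^ 2 * ‖Q ξ s‖ ^ 2 := fun ξ => by
    rw [norm_sub_sq_real, inner_smul_right, norm_smul, mul_pow, Real.norm_eq_abs, sq_abs]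
  simp only [hexp]
  rw [integral_add h2 ((hQ.integrable_sq s).const_mul _), integral_sub (integrable_const _) h1,
    integral_const_mul, integral_const_mul, integral_const_mul, integral_inner (hQ.integrable s),
    hQ.unbiased, real_inner_self_eq_norm_sq]
  have := mul_le_mul_of_nonneg_left (hQ.second_moment s) (sq_nonneg β)
  simp only [integral_const, probReal_univ, smul_eq_mul, one_mul]
  linarith

theorem IsCompressor.integral_norm_sub_self_sq_le (s : Vec q) :
    ∫ ξ, ‖Q ξ s - s‖ ^ 2 ∂ν ≤ ω * ‖s‖ ^ 2 := by
  have h := hQ.integral_norm_sub_smul_sq_le s 1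
  simp only [one_smul, norm_sub_rev s] at h
  linarith

/-- One damped memory update is a contraction in quadratic mean. -/
theorem IsCompressor.integral_norm_sub_alpha_sq_le (s : Vec q) :
    ∫ ξ, ‖s - (1 / (1 + ω)) • Q ξ s‖ ^ 2 ∂ν ≤ ω / (1 + ω) * ‖s‖ ^ 2 := by
  have hω : (1 + ω) ≠ 0 := by linarith [hQ.omega_nonneg]
  refine (hQ.integral_norm_sub_smul_sq_le s _).trans (le_of_eq ?_)
  congr 1
  field_simp
  ring

theorem IsCompressor.memLp_field (c : Vec q) (v : Fin n → Vec q) :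
    MemLp (fun ξ : Fin n → Ξ => c + (n : ℝ)⁻¹ • ∑ i, (Q (ξ i) (v i) - v i)) 2
      (Measure.pi fun _ => ν) :=
  (memLp_const c).add ((memLp_finsetSum _ fun i _ =>
    memLp_two_comp_eval ν (hQ.memLp_sub (v i)) i).const_smul (n : ℝ)⁻¹)

theorem IsCompressor.integral_norm_field_sq (c : Vec q) (v : Fin n → Vec q) :
    ∫ ξ : Fin n → Ξ, ‖c + (n : ℝ)⁻¹ • ∑ i, (Q (ξ i) (v i) - v i)‖ ^ 2 ∂(Measure.pi fun _ => ν) =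
      ‖c‖ ^ 2 + ((n : ℝ)⁻¹) ^ 2 * ∑ i, ∫ ξ, ‖Q ξ (v i) - v i‖ ^ 2 ∂ν := by
  have h := integral_norm_add_sum_sq ν c (fun i ξ => (n : ℝ)⁻¹ • (Q ξ (v i) - v i))
    (fun i => (hQ.memLp_sub (v i)).const_smul (n : ℝ)⁻¹)
    (fun i => by rw [integral_smul, hQ.integral_sub_self, smul_zero])
  simp only [← Finset.smul_sum] at h
  rw [h, Finset.mul_sum]
  congr 1
  refine Finset.sum_congr rfl fun i _ => ?_
  simp only [norm_smul, mul_pow, norm_inv, Real.norm_natCast, integral_const_mul]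

end Compression

/-! ### The error quantities of a state -/

section State

variable {n m q b : ℕ} {Ξ : Type*}

/-- The mean field `n⁻¹ ∑ᵢ (m⁻¹ ∑ⱼ g i j s - s)`. -/
noncomputable def meanField (g : Fin n → Fin m → Vec q → Vec q) (s : Vec q) : Vec q :=
  (n : ℝ)⁻¹ • ∑ i, (fullPass g s i - s)

/-- The error of the local statistics of worker `i`, which estimate a full pass over its data at
the previous iterate. -/
noncomputable def statErr (g : Fin n → Fin m → Vec q → Vec q) (σ : State n q) (i : Fin n) :
    Vec q :=
  σ.Sloc i - fullPass g σ.Sprev i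

/-- The average over the workers of the errors of their local statistics. -/
noncomputable def meanErr (g : Fin n → Fin m → Vec q → Vec q) (σ : State n q) : Vec q :=
  (n : ℝ)⁻¹ • ∑ i, statErr g σ i

/-- The gap between the memory of worker `i` and the local field that it tracks. -/
noncomputable def memGap (σ : State n q) (i : Fin n) : Vec q := σ.Sloc i - σ.Sprev - σ.Vloc i

/-- The vector `Δ_{t,k+1,i}` that worker `i` compresses. -/
noncomputable def residual (g : Fin n → Fin m → Vec q → Vec q) (B : Fin n → Fin b → Fin m)
    (σ : State n q) (i : Fin n) : Vec q :=
  nextSloc g B σ i - σ.S - σ.Vloc i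

/-- The error of the local statistics of worker `i` after the next iteration; it depends on the
mini-batches only. -/
noncomputable def nextErr (g : Fin n → Fin m → Vec q → Vec q) (B : Fin n → Fin b → Fin m)
    (σ : State n q) (i : Fin n) : Vec q :=
  nextSloc g B σ i - fullPass g σ.S i

/-- The mean square over the workers. -/
noncomputable def avgSq (v : Fin n → Vec q) : ℝ := (n : ℝ)⁻¹ * ∑ i, ‖v i‖ ^ 2

/-- The increment of `s ↦ g i j s - s` along the last move of the iterate. -/
noncomputable def increment (g : Fin n → Fin m → Vec q → Vec q) (σ : State n q) (i : Fin n)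
    (j : Fin m) : Vec q :=
  (g i j σ.S - σ.S) - (g i j σ.Sprev - σ.Sprev)

theorem avgSq_nonneg (v : Fin n → Vec q) : 0 ≤ avgSq v := by
  unfold avgSq
  positivity

variable (g : Fin n → Fin m → Vec q → Vec q)

theorem residual_eq (hb : 0 < b) (B : Fin n → Fin b → Fin m) (σ : State n q) (i : Fin n) :
    residual g B σ i = memGap σ i + (b : ℝ)⁻¹ • ∑ l, increment g σ i (B i l) := by
  have hb' : (b : ℝ) ≠ 0 := by positivity
  have h : ∑ l, increment g σ i (B i l) =
      ∑ l, (g i (B i l) σ.S - g i (B i l) σ.Sprev) - (b : ℝ) • (σ.S - σ.Sprev) := by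
    have : ∀ l, increment g σ i (B i l) =
        (g i (B i l) σ.S - g i (B i l) σ.Sprev) - (σ.S - σ.Sprev) := fun l => by
      unfold increment
      abel
    simp only [this]
    rw [Finset.sum_sub_distrib]
    simp [Nat.cast_smul_eq_nsmul, smul_sub]
  rw [h, smul_sub, inv_smul_smul₀ hb']
  unfold residual memGap nextSloc
  abel

theorem mean_increment (hm : 0 < m) (σ : State n q) (i : Fin n) :
    (m : ℝ)⁻¹ • ∑ j, increment g σ i j =
      (fullPass g σ.S i - σ.S) - (fullPass g σ.Sprev i - σ.Sprev) := by
  have hm' : (m : ℝ) ≠ 0 := by positivity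
  unfold increment fullPass
  simp only [Finset.sum_sub_distrib, smul_sub, Finset.sum_const, Finset.card_univ,
    Fintype.card_fin, ← Nat.cast_smul_eq_nsmul ℝ, inv_smul_smul₀ hm']

theorem nextErr_eq (hb : 0 < b) (hm : 0 < m) (B : Fin n → Fin b → Fin m) (σ : State n q)
    (i : Fin n) :
    nextErr g B σ i = statErr g σ i + (b : ℝ)⁻¹ • ∑ l, centered (increment g σ i) (B i l) := by
  have hb' : (b : ℝ) ≠ 0 := by positivity
  have h := residual_eq g hb B σ i
  have h2 : (b : ℝ)⁻¹ • ∑ l, centered (increment g σ i) (B i l) =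
      (b : ℝ)⁻¹ • ∑ l, increment g σ i (B i l) -
        ((fullPass g σ.S i - σ.S) - (fullPass g σ.Sprev i - σ.Sprev)) := by
    rw [← mean_increment g hm]
    simp only [centered, Finset.sum_sub_distrib, smul_sub, Finset.sum_const, Finset.card_univ,
      Fintype.card_fin, ← Nat.cast_smul_eq_nsmul ℝ, inv_smul_smul₀ hb']
  rw [h2, ← sub_eq_iff_eq_add'.2 h]
  unfold nextErr statErr residual memGap
  abel

theorem meanField_add_mean_nextErr (B : Fin n → Fin b → Fin m) (σ : State n q)
    (hV : σ.V = (n : ℝ)⁻¹ • ∑ i, σ.Vloc i) :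
    meanField g σ.S + (n : ℝ)⁻¹ • ∑ i, nextErr g B σ i =
      σ.V + (n : ℝ)⁻¹ • ∑ i, residual g B σ i := by
  rw [hV, meanField, ← smul_add, ← smul_add, ← Finset.sum_add_distrib, ← Finset.sum_add_distrib]
  congr 1
  refine Finset.sum_congr rfl fun i _ => ?_
  unfold nextErr residual
  abel

/-- The field is the mean field, plus the mini-batch error, plus the compression error. -/
theorem nextH_eq (Q : Ξ → Vec q → Vec q) (B : Fin n → Fin b → Fin m) (ξ : Fin n → Ξ)
    (σ : State n q) (hV : σ.V = (n : ℝ)⁻¹ • ∑ i, σ.Vloc i) :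
    nextH g Q B ξ σ = meanField g σ.S + (n : ℝ)⁻¹ • ∑ i, nextErr g B σ i +
      (n : ℝ)⁻¹ • ∑ i, (Q (ξ i) (residual g B σ i) - residual g B σ i) := by
  rw [meanField_add_mean_nextErr g B σ hV, Finset.sum_sub_distrib, smul_sub]
  unfold nextH message
  simp only [residual]
  abel

variable {g} {Lip : Fin n → Fin m → ℝ}
  (hLip : ∀ i j (s s' : Vec q), ‖(g i j s - s) - (g i j s' - s')‖ ≤ Lip i j * ‖s - s'‖)
include hLip

theorem sum_norm_increment_sq_le (σ : State n q) (i : Fin n) :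
    ∑ j, ‖increment g σ i j‖ ^ 2 ≤ (∑ j, Lip i j ^ 2) * ‖σ.S - σ.Sprev‖ ^ 2 := by
  rw [Finset.sum_mul]
  refine Finset.sum_le_sum fun j _ => ?_
  rw [← mul_pow]
  exact pow_le_pow_left₀ (norm_nonneg _) (hLip i j _ _) 2

omit hLip in
theorem meanLip_sq : meanLip Lip ^ 2 = (n : ℝ)⁻¹ * ∑ i, (m : ℝ)⁻¹ * ∑ j, Lip i j ^ 2 := by
  rw [meanLip, Real.sq_sqrt (by positivity), ← Finset.mul_sum]
  ring

/-! ### Moments of the errors after one iteration -/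

section Batch

variable (hb : 0 < b) (hm : 0 < m) (sch : Sampling) [IsProbabilityMeasure (batchLaw b m sch)]
include hb hm

theorem integral_mean_nextErr_sq_le (hn : 0 < n) (σ : State n q) :
    ∫ B : Fin n → Fin b → Fin m, ‖(n : ℝ)⁻¹ • ∑ i, nextErr g B σ i‖ ^ 2
        ∂(Measure.pi fun _ => batchLaw b m sch) ≤
      ‖meanErr g σ‖ ^ 2 + meanLip Lip ^ 2 / (n * b) * ‖σ.S - σ.Sprev‖ ^ 2 := by
  have h := integral_norm_add_sum_sq (batchLaw b m sch) (meanErr g σ)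
    (fun i B => (n : ℝ)⁻¹ • ((b : ℝ)⁻¹ • ∑ l, centered (increment g σ i) (B l)))
    (fun i => MemLp.of_discrete)
    (fun i => by rw [integral_smul, integral_batch_centered hb hm, smul_zero])
  simp only [nextErr_eq g hb hm, Finset.sum_add_distrib, smul_add]
  simp only [meanErr, ← Finset.smul_sum] at h ⊢
  rw [h]
  gcongr
  calc ∑ i, ∫ B : Fin b → Fin m,
          ‖(n : ℝ)⁻¹ • ((b : ℝ)⁻¹ • ∑ l, centered (increment g σ i) (B l))‖ ^ 2
            ∂(batchLaw b m sch)
      ≤ ∑ i, ((n : ℝ)⁻¹) ^ 2 * ((b : ℝ)⁻¹ *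
          ((m : ℝ)⁻¹ * ((∑ j, Lip i j ^ 2) * ‖σ.S - σ.Sprev‖ ^ 2))) := by
        refine Finset.sum_le_sum fun i _ => ?_
        simp only [norm_smul (n : ℝ)⁻¹, mul_pow, norm_inv, Real.norm_natCast, integral_const_mul]
        gcongr
        refine (integral_batch_centered_sq_le hb hm sch _).trans ?_
        gcongr
        exact sum_norm_increment_sq_le hLip σ i
    _ = _ := by
        rw [meanLip_sq, ← Finset.mul_sum, ← Finset.mul_sum, ← Finset.mul_sum, ← Finset.sum_mul,
          ← Finset.mul_sum]
        field_simp

theorem integral_avgSq_nextErr_le (σ : State n q) :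
    ∫ B : Fin n → Fin b → Fin m, avgSq (nextErr g B σ) ∂(Measure.pi fun _ => batchLaw b m sch) ≤
      avgSq (statErr g σ) + meanLip Lip ^ 2 / b * ‖σ.S - σ.Sprev‖ ^ 2 := by
  have h : ∀ i, ∫ B : Fin n → Fin b → Fin m, ‖nextErr g B σ i‖ ^ 2
        ∂(Measure.pi fun _ => batchLaw b m sch) ≤
      ‖statErr g σ i‖ ^ 2 + (b : ℝ)⁻¹ *
          ((m : ℝ)⁻¹ * ((∑ j, Lip i j ^ 2) * ‖σ.S - σ.Sprev‖ ^ 2)) := by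
    intro i
    simp only [nextErr_eq g hb hm]
    rw [integral_comp_eval (batchLaw b m sch) (f := fun B : Fin b → Fin m =>
      ‖statErr g σ i + (b : ℝ)⁻¹ • ∑ l, centered (increment g σ i) (B l)‖ ^ 2)
      AEStronglyMeasurable.of_discrete,
      integral_norm_add_sq _ MemLp.of_discrete (integral_batch_centered hb hm sch _)]
    gcongr
    refine (integral_batch_centered_sq_le hb hm sch _).trans ?_
    gcongr
    exact sum_norm_increment_sq_le hLip σ i
  unfold avgSq
  rw [integral_const_mul, integral_finsetSum _ fun i _ => .of_finite]
  calc _ ≤ (n : ℝ)⁻¹ * ∑ i, (‖statErr g σ i‖ ^ 2 + (b : ℝ)⁻¹ *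
          ((m : ℝ)⁻¹ * ((∑ j, Lip i j ^ 2) * ‖σ.S - σ.Sprev‖ ^ 2))) := by
        gcongr with i
        exact h i
    _ = _ := by
        rw [meanLip_sq, Finset.sum_add_distrib, ← Finset.mul_sum, ← Finset.mul_sum,
          ← Finset.sum_mul, ← Finset.mul_sum]
        field_simp

omit hLip hb hm in
/-- A weighted Young inequality. Its weights stay bounded as `ω → 0`: the contraction
`ω / (1 + ω)` of the memory gaps then becomes perfect, and no room is needed. -/
theorem mul_norm_add_sq_le {ω : ℝ} (hω : 0 ≤ ω) (u v : Vec q) :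
    ω * ‖u + v‖ ^ 2 ≤ (ω + 1 / 2) * ‖u‖ ^ 2 + ω * (1 + 2 * ω) * ‖v‖ ^ 2 := by
  have h1 := norm_add_le u v
  have h2 : ‖u + v‖ ^ 2 ≤ (‖u‖ + ‖v‖) ^ 2 := pow_le_pow_left₀ (norm_nonneg _) h1 2
  have h3 := mul_le_mul_of_nonneg_left h2 hω
  nlinarith [sq_nonneg (‖u‖ - 2 * ω * ‖v‖)]

theorem mul_integral_avgSq_residual_le {ω : ℝ} (hω : 0 ≤ ω) (σ : State n q) :
    ω * ∫ B : Fin n → Fin b → Fin m, avgSq (residual g B σ)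
        ∂(Measure.pi fun _ => batchLaw b m sch) ≤
      (ω + 1 / 2) * avgSq (memGap σ) +
        ω * (1 + 2 * ω) * (meanLip Lip ^ 2 * ‖σ.S - σ.Sprev‖ ^ 2) := by
  have h : ∀ i, ω * ∫ B : Fin n → Fin b → Fin m, ‖residual g B σ i‖ ^ 2
        ∂(Measure.pi fun _ => batchLaw b m sch) ≤
      (ω + 1 / 2) * ‖memGap σ i‖ ^ 2 + ω * (1 + 2 * ω) *
          ((m : ℝ)⁻¹ * ((∑ j, Lip i j ^ 2) * ‖σ.S - σ.Sprev‖ ^ 2)) := by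
    intro i
    simp only [residual_eq g hb]
    rw [integral_comp_eval (batchLaw b m sch) (f := fun B : Fin b → Fin m =>
      ‖memGap σ i + (b : ℝ)⁻¹ • ∑ l, increment g σ i (B l)‖ ^ 2)
      AEStronglyMeasurable.of_discrete, ← integral_const_mul]
    refine (integral_mono .of_finite .of_finite fun B : Fin b → Fin m =>
      mul_norm_add_sq_le hω _ _).trans ?_
    rw [integral_add (integrable_const _) .of_finite, integral_const, probReal_univ, one_smul,
      integral_const_mul]
    gcongr
    refine (integral_batch_sq_le hb hm sch _).trans ?_
    gcongr
    exact sum_norm_increment_sq_le hLip σ i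
  unfold avgSq
  rw [integral_const_mul, integral_finsetSum _ fun i _ => .of_finite, mul_left_comm,
    Finset.mul_sum]
  calc _ ≤ (n : ℝ)⁻¹ * ∑ i, ((ω + 1 / 2) * ‖memGap σ i‖ ^ 2 + ω * (1 + 2 * ω) *
          ((m : ℝ)⁻¹ * ((∑ j, Lip i j ^ 2) * ‖σ.S - σ.Sprev‖ ^ 2))) := by
        gcongr with i
        exact h i
    _ = _ := by
        rw [meanLip_sq, Finset.sum_add_distrib, ← Finset.mul_sum, ← Finset.mul_sum,
          ← Finset.mul_sum, ← Finset.sum_mul, ← Finset.mul_sum]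
        ring

omit hLip hm in
theorem residual_eq_memGap (B : Fin n → Fin b → Fin m) {σ : State n q} (hd : σ.S = σ.Sprev)
    (i : Fin n) : residual g B σ i = memGap σ i := by
  rw [residual_eq g hb]
  simp [increment, hd]

end Batch

end State

/-! ### Measurability of the iterations -/

section Measurability

variable {n m q b : ℕ} {Ξ : Type*}

/-- The product σ-algebra on the six components of a state. -/
instance instMeasurableSpaceState : MeasurableSpace (State n q) :=
  MeasurableSpace.comap (fun σ => (σ.S, σ.Sprev, σ.Sloc, σ.Vloc, σ.V, σ.H)) inferInstance

theorem measurable_components : Measurable (fun σ : State n q =>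
    (σ.S, σ.Sprev, σ.Sloc, σ.Vloc, σ.V, σ.H)) :=
  comap_measurable _

@[fun_prop]
theorem measurable_S : Measurable (State.S : State n q → Vec q) := measurable_components.fst

@[fun_prop]
theorem measurable_Sprev : Measurable (State.Sprev : State n q → Vec q) :=
  measurable_components.snd.fst

@[fun_prop]
theorem measurable_Sloc : Measurable (State.Sloc : State n q → Fin n → Vec q) :=
  measurable_components.snd.snd.fst

@[fun_prop]
theorem measurable_Vloc : Measurable (State.Vloc : State n q → Fin n → Vec q) :=
  measurable_components.snd.snd.snd.fst

@[fun_prop]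
theorem measurable_V : Measurable (State.V : State n q → Vec q) :=
  measurable_components.snd.snd.snd.snd.fst

@[fun_prop]
theorem measurable_H : Measurable (State.H : State n q → Vec q) :=
  measurable_components.snd.snd.snd.snd.snd

theorem measurable_state {α : Type*} {_ : MeasurableSpace α} {f : α → State n q}
    (hS : Measurable fun x => (f x).S) (hSprev : Measurable fun x => (f x).Sprev)
    (hSloc : Measurable fun x => (f x).Sloc) (hVloc : Measurable fun x => (f x).Vloc)
    (hV : Measurable fun x => (f x).V) (hH : Measurable fun x => (f x).H) : Measurable f :=
  measurable_comap_iff.2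
    (hS.prodMk (hSprev.prodMk (hSloc.prodMk (hVloc.prodMk (hV.prodMk hH)))))

variable [MeasurableSpace Ξ] {g : Fin n → Fin m → Vec q → Vec q} {Q : Ξ → Vec q → Vec q}
  (hg : ∀ i j, Measurable (g i j))
include hg

theorem measurable_fullPass (i : Fin n) : Measurable fun s => fullPass g s i := by
  unfold fullPass
  fun_prop

theorem measurable_initState : Measurable fun p : Vec q × (Fin n → Vec q) =>
    initState g p.1 p.2 := by
  have h := measurable_fullPass hg
  refine measurable_state ?_ ?_ (measurable_pi_iff.2 fun i => ?_) ?_ ?_ ?_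
  · exact measurable_fst
  · exact measurable_fst
  · exact (h i).comp measurable_fst
  · exact measurable_snd
  · simp only [initState]
    fun_prop
  · exact measurable_const

theorem measurable_restart : Measurable (restart g : State n q → State n q) := by
  have h := measurable_fullPass hg
  refine measurable_state ?_ ?_ (measurable_pi_iff.2 fun i => ?_) ?_ ?_ ?_
  · exact measurable_S
  · exact measurable_S
  · exact (h i).comp measurable_S
  · exact measurable_Vloc
  · exact measurable_V
  · exact measurable_const

theorem measurable_nextSloc (i : Fin n) : Measurable fun
    p : (Fin n → Fin b → Fin m) × State n q => nextSloc g p.1 p.2 i := by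
  have h : ∀ l : Fin b, Measurable fun p : (Fin n → Fin b → Fin m) × State n q =>
      g i (p.1 i l) p.2.S - g i (p.1 i l) p.2.Sprev := fun l =>
    measurable_from_prod_countable_right fun B => by
      have := hg i (B i l)
      simp only
      fun_prop
  unfold nextSloc
  fun_prop

/-- The triple of a state, mini-batches and compression noises determines the next state in a
measurable way. -/
theorem measurable_step (hQ : Measurable (Function.uncurry Q)) (α γ : ℝ) :
    Measurable fun p : State n q × (Fin n → Fin b → Fin m) × (Fin n → Ξ) =>
      step g Q α γ p.2.1 p.2.2 p.1 := by
  have h1 : ∀ i, Measurable fun p : State n q × (Fin n → Fin b → Fin m) × (Fin n → Ξ) =>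
      nextSloc g p.2.1 p.1 i := fun i =>
    (measurable_nextSloc hg i).comp (measurable_snd.fst.prodMk measurable_fst)
  have h2 : ∀ i, Measurable fun p : State n q × (Fin n → Fin b → Fin m) × (Fin n → Ξ) =>
      message g Q p.2.1 p.2.2 p.1 i := fun i => by
    have h3 := h1 i
    exact hQ.comp (f := fun p : State n q × (Fin n → Fin b → Fin m) × (Fin n → Ξ) =>
      (p.2.2 i, nextSloc g p.2.1 p.1 i - p.1.S - p.1.Vloc i)) (by fun_prop)
  have h3 : Measurable fun p : State n q × (Fin n → Fin b → Fin m) × (Fin n → Ξ) =>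
      nextH g Q p.2.1 p.2.2 p.1 := by
    unfold nextH
    fun_prop
  refine measurable_state ?_ ?_ (measurable_pi_iff.2 h1) (measurable_pi_iff.2 fun i => ?_) ?_ h3
  · simp only [step]
    fun_prop
  · exact measurable_S.comp measurable_fst
  · simp only [step]
    fun_prop
  · simp only [step]
    fun_prop

end Measurability

/-! ### One iteration from a given state -/

section OneStep

variable {n m q b : ℕ} {Ξ : Type*} [MeasurableSpace Ξ]

/-- The law of the mini-batches and of the compression noises of one iteration. -/
noncomputable def noiseLaw (n b m : ℕ) (sch : Sampling) (ν : Measure Ξ) :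
    Measure ((Fin n → Fin b → Fin m) × (Fin n → Ξ)) :=
  (Measure.pi fun _ => batchLaw b m sch).prod (Measure.pi fun _ => ν)

/-- The potential of the mini-batch errors when `r` iterations remain in the outer loop. -/
noncomputable def errPot (g : Fin n → Fin m → Vec q → Vec q) (κ r : ℝ) (σ : State n q) : ℝ :=
  r * (‖meanErr g σ‖ ^ 2 + κ * ‖σ.S - σ.Sprev‖ ^ 2)

/-- The potential of the compression errors. The weight `δ` of the memory gaps is smaller at the
start of an outer loop, where the iterate has not moved yet. -/
noncomputable def memPot (g : Fin n → Fin m → Vec q → Vec q) (ω L δ : ℝ) (σ : State n q) : ℝ :=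
  2 * (1 + ω) * (δ * avgSq (memGap σ) +
    2 * ω * (1 + 2 * ω) * (avgSq (statErr g σ) + 3 / 2 * (L ^ 2 * ‖σ.S - σ.Sprev‖ ^ 2)))

variable {g : Fin n → Fin m → Vec q → Vec q} {Q : Ξ → Vec q → Vec q} {ω : ℝ} {ν : Measure Ξ}
  [IsProbabilityMeasure ν]

theorem errPot_nonneg {κ r : ℝ} (hκ : 0 ≤ κ) (hr : 0 ≤ r) (σ : State n q) :
    0 ≤ errPot g κ r σ := by
  unfold errPot
  positivity

theorem memPot_nonneg {L δ : ℝ} (hω : 0 ≤ ω) (hδ : 0 ≤ δ) (σ : State n q) :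
    0 ≤ memPot g ω L δ σ := by
  unfold memPot
  have h1 := avgSq_nonneg (memGap σ)
  have h2 := avgSq_nonneg (statErr g σ)
  positivity

omit [MeasurableSpace Ξ] in
theorem statErr_step (α γ : ℝ) (B : Fin n → Fin b → Fin m) (ξ : Fin n → Ξ) (σ : State n q) :
    statErr g (step g Q α γ B ξ σ) = nextErr g B σ := rfl

omit [MeasurableSpace Ξ] in
theorem meanErr_step (α γ : ℝ) (B : Fin n → Fin b → Fin m) (ξ : Fin n → Ξ) (σ : State n q) :
    meanErr g (step g Q α γ B ξ σ) = (n : ℝ)⁻¹ • ∑ i, nextErr g B σ i := rfl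

omit [MeasurableSpace Ξ] in
theorem step_H (α γ : ℝ) (B : Fin n → Fin b → Fin m) (ξ : Fin n → Ξ) (σ : State n q) :
    (step g Q α γ B ξ σ).H = nextH g Q B ξ σ := rfl

omit [MeasurableSpace Ξ] in
theorem norm_move_step_sq (α γ : ℝ) (B : Fin n → Fin b → Fin m) (ξ : Fin n → Ξ)
    (σ : State n q) :
    ‖(step g Q α γ B ξ σ).S - (step g Q α γ B ξ σ).Sprev‖ ^ 2 =
      γ ^ 2 * ‖nextH g Q B ξ σ‖ ^ 2 := by
  simp [step, norm_smul, mul_pow]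

section Noise

variable (hQ : IsCompressor ν Q ω)
include hQ

theorem memLp_nextH (B : Fin n → Fin b → Fin m) {σ : State n q}
    (hV : σ.V = (n : ℝ)⁻¹ • ∑ i, σ.Vloc i) :
    MemLp (fun ξ => nextH g Q B ξ σ) 2 (Measure.pi fun _ => ν) := by
  simp only [nextH_eq g Q B _ σ hV]
  exact hQ.memLp_field _ _

theorem integral_nextH_sub_sq_le (B : Fin n → Fin b → Fin m) {σ : State n q}
    (hV : σ.V = (n : ℝ)⁻¹ • ∑ i, σ.Vloc i) :
    ∫ ξ, ‖nextH g Q B ξ σ - meanField g σ.S‖ ^ 2 ∂(Measure.pi fun _ => ν) ≤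
      ‖(n : ℝ)⁻¹ • ∑ i, nextErr g B σ i‖ ^ 2 + ω / n * avgSq (residual g B σ) := by
  have h : ∀ ξ, nextH g Q B ξ σ - meanField g σ.S = (n : ℝ)⁻¹ • ∑ i, nextErr g B σ i +
      (n : ℝ)⁻¹ • ∑ i, (Q (ξ i) (residual g B σ i) - residual g B σ i) := fun ξ => by
    rw [nextH_eq g Q B ξ σ hV]
    abel
  simp only [h]
  rw [hQ.integral_norm_field_sq]
  refine add_le_add le_rfl ?_
  calc ((n : ℝ)⁻¹) ^ 2 * ∑ i, ∫ ξ, ‖Q ξ (residual g B σ i) - residual g B σ i‖ ^ 2 ∂ν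
      ≤ ((n : ℝ)⁻¹) ^ 2 * ∑ i, ω * ‖residual g B σ i‖ ^ 2 := by
        gcongr with i
        exact hQ.integral_norm_sub_self_sq_le _
    _ = _ := by
        rw [← Finset.mul_sum]
        unfold avgSq
        ring

theorem norm_meanField_sq_le (B : Fin n → Fin b → Fin m) {σ : State n q}
    (hV : σ.V = (n : ℝ)⁻¹ • ∑ i, σ.Vloc i) :
    ‖meanField g σ.S‖ ^ 2 ≤ 2 * ∫ ξ, ‖nextH g Q B ξ σ‖ ^ 2 ∂(Measure.pi fun _ => ν) +
      2 * ‖(n : ℝ)⁻¹ • ∑ i, nextErr g B σ i‖ ^ 2 := by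
  simp only [nextH_eq g Q B _ σ hV]
  rw [hQ.integral_norm_field_sq]
  set e := (n : ℝ)⁻¹ • ∑ i, nextErr g B σ i
  have h1 : ‖meanField g σ.S‖ ≤ ‖meanField g σ.S + e‖ + ‖e‖ := by
    simpa using norm_sub_le (meanField g σ.S + e) e
  have h2 : 0 ≤ ((n : ℝ)⁻¹) ^ 2 *
      ∑ i, ∫ ξ, ‖Q ξ (residual g B σ i) - residual g B σ i‖ ^ 2 ∂ν :=
    mul_nonneg (sq_nonneg _) (Finset.sum_nonneg fun i _ => integral_nonneg fun ξ => sq_nonneg _)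
  have h3 : ‖meanField g σ.S‖ ^ 2 ≤ (‖meanField g σ.S + e‖ + ‖e‖) ^ 2 :=
    pow_le_pow_left₀ (norm_nonneg _) h1 2
  nlinarith [sq_nonneg (‖meanField g σ.S + e‖ - ‖e‖)]

theorem integrable_memGap_step_sq (γ : ℝ) (B : Fin n → Fin b → Fin m) (σ : State n q)
    (i : Fin n) :
    Integrable (fun ξ => ‖memGap (step g Q (1 / (1 + ω)) γ B ξ σ) i‖ ^ 2)
      (Measure.pi fun _ => ν) := by
  have h : ∀ ξ, memGap (step g Q (1 / (1 + ω)) γ B ξ σ) i =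
      residual g B σ i - (1 / (1 + ω)) • Q (ξ i) (residual g B σ i) := fun ξ => by
    simp only [memGap, step, message, residual]
    abel
  simp only [h]
  exact ((memLp_const _).sub ((memLp_two_comp_eval ν (hQ.memLp _) i).const_smul
    (1 / (1 + ω)))).norm.integrable_sq

theorem integral_avgSq_memGap_step_le (γ : ℝ) (B : Fin n → Fin b → Fin m) (σ : State n q) :
    ∫ ξ, avgSq (memGap (step g Q (1 / (1 + ω)) γ B ξ σ)) ∂(Measure.pi fun _ => ν) ≤
      ω / (1 + ω) * avgSq (residual g B σ) := by
  have h : ∀ i, ∫ ξ, ‖memGap (step g Q (1 / (1 + ω)) γ B ξ σ) i‖ ^ 2 ∂(Measure.pi fun _ => ν) ≤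
      ω / (1 + ω) * ‖residual g B σ i‖ ^ 2 := fun i => by
    have h1 : ∀ ξ, memGap (step g Q (1 / (1 + ω)) γ B ξ σ) i =
        residual g B σ i - (1 / (1 + ω)) • Q (ξ i) (residual g B σ i) := fun ξ => by
      simp only [memGap, step, message, residual]
      abel
    simp only [h1]
    rw [integral_comp_eval ν (f := fun ξ =>
      ‖residual g B σ i - (1 / (1 + ω)) • Q ξ (residual g B σ i)‖ ^ 2)
      ((memLp_const _).sub ((hQ.memLp _).const_smul (1 / (1 + ω)))).norm.integrable_sq.1]
    exact hQ.integral_norm_sub_alpha_sq_le _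
  unfold avgSq
  rw [integral_const_mul, integral_finsetSum _ fun i _ => integrable_memGap_step_sq hQ γ B σ i]
  refine (mul_le_mul_of_nonneg_left (Finset.sum_le_sum fun i _ => h i)
    (by positivity : 0 ≤ (n : ℝ)⁻¹)).trans_eq ?_
  rw [← Finset.mul_sum]
  ring

end Noise

theorem lintegral_ofReal_le {α : Type*} [MeasurableSpace α] {μ : Measure α} {f : α → ℝ} {c : ℝ}
    (hf : Integrable f μ) (h0 : ∀ x, 0 ≤ f x) (h : ∫ x, f x ∂μ ≤ c) :
    ∫⁻ x, ENNReal.ofReal (f x) ∂μ ≤ ENNReal.ofReal c := by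
  rw [← ofReal_integral_eq_lintegral_ofReal hf (Filter.Eventually.of_forall h0)]
  exact ENNReal.ofReal_le_ofReal h

variable (hQ : IsCompressor ν Q ω) (hg : ∀ i j, Measurable (g i j))
  {Lip : Fin n → Fin m → ℝ}
  (hLip : ∀ i j (s s' : Vec q), ‖(g i j s - s) - (g i j s' - s')‖ ≤ Lip i j * ‖s - s'‖)
  (hn : 0 < n) (hb : 0 < b) (hm : 0 < m) (sch : Sampling)
  [IsProbabilityMeasure (batchLaw b m sch)]

theorem measurable_meanErr (hg : ∀ i j, Measurable (g i j)) : Measurable (meanErr g) := by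
  have := measurable_fullPass hg
  unfold meanErr statErr
  fun_prop

theorem measurable_errPot (hg : ∀ i j, Measurable (g i j)) (κ r : ℝ) :
    Measurable (errPot g κ r) := by
  have := measurable_meanErr hg
  unfold errPot
  fun_prop

theorem measurable_memPot (hg : ∀ i j, Measurable (g i j)) (ω L δ : ℝ) :
    Measurable (memPot g ω L δ) := by
  have := measurable_fullPass hg
  unfold memPot avgSq memGap statErr
  fun_prop

omit [IsProbabilityMeasure (batchLaw b m sch)] in
include hQ hg in
theorem lintegral_noiseLaw {F : State n q → ENNReal} (hF : Measurable F) (α γ : ℝ)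
    (σ : State n q) :
    ∫⁻ z, F (step g Q α γ z.1 z.2 σ) ∂(noiseLaw n b m sch ν) =
      ∫⁻ B, ∫⁻ ξ, F (step g Q α γ B ξ σ) ∂(Measure.pi fun _ => ν)
        ∂(Measure.pi fun _ => batchLaw b m sch) := by
  rw [noiseLaw, lintegral_prod]
  exact (hF.comp ((measurable_step hg hQ.measurable α γ).comp
    (measurable_const.prodMk measurable_id))).aemeasurable

include hQ hg hLip hn hb hm in
/-- The expected potential, made of the objective, the mini-batch errors and the compression
errors, decreases along an iteration by at least `c` times the expected square of the field `H`.
The hypothesis `hc` says that the gain in the descent inequality `hdesc` exceeds `c` by what `H`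
adds to the two error potentials when it moves the iterate. -/
theorem lintegral_potential_step_le {f : Vec q → ℝ} (hf : Measurable f)
    {w vmin vmax LW γ C c r δ κ : ℝ}
    (hw : ∀ s, w ≤ f s) (hvmax : 0 ≤ vmax) (hC : 0 < C) (hr : 0 ≤ r)
    (hdesc : ∀ s v, f (s + γ • v) ≤ f s + vmax / (2 * C) * ‖v - meanField g s‖ ^ 2 -
      (γ * vmin - γ ^ 2 * (vmax * C / 2 + LW / 2)) * ‖v‖ ^ 2)
    (hκ : κ = meanLip Lip ^ 2 / (n * b))
    (hc0 : 0 ≤ c)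
    (hc : c + vmax / (2 * C) * (r * κ) * γ ^ 2 +
      vmax / (2 * C) / n * (6 * ω * (1 + ω) * (1 + 2 * ω) * meanLip Lip ^ 2) * γ ^ 2 ≤
      γ * vmin - γ ^ 2 * (vmax * C / 2 + LW / 2))
    {σ : State n q} (hV : σ.V = (n : ℝ)⁻¹ • ∑ i, σ.Vloc i)
    (hδ : δ = ω + 1 / 2 ∨ δ = ω ∧ σ.S = σ.Sprev) :
    ∫⁻ z, (ENNReal.ofReal (f (step g Q (1 / (1 + ω)) γ z.1 z.2 σ).S - w +
          vmax / (2 * C) * errPot g κ r (step g Q (1 / (1 + ω)) γ z.1 z.2 σ) +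
          vmax / (2 * C) / n *
            memPot g ω (meanLip Lip) (ω + 1 / 2) (step g Q (1 / (1 + ω)) γ z.1 z.2 σ)) +
        ENNReal.ofReal (c * ‖(step g Q (1 / (1 + ω)) γ z.1 z.2 σ).H‖ ^ 2))
      ∂(noiseLaw n b m sch ν) ≤
    ENNReal.ofReal (f σ.S - w + vmax / (2 * C) * errPot g κ (r + 1) σ +
      vmax / (2 * C) / n * memPot g ω (meanLip Lip) δ σ) := by
  have hω := hQ.omega_nonneg
  set lam := vmax / (2 * C) with hlam_def
  have hlam : 0 ≤ lam := by positivity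
  have hκ0 : 0 ≤ κ := by rw [hκ]; positivity
  have hn' : (0 : ℝ) < n := by positivity
  have hb1 : (1 : ℝ) ≤ b := by exact_mod_cast hb
  have hmF := measurable_errPot hg κ r
  have hmM := measurable_memPot hg ω (meanLip Lip) (ω + 1 / 2)
  rw [lintegral_noiseLaw hQ hg sch (F := fun σ' => ENNReal.ofReal (f σ'.S - w +
    lam * errPot g κ r σ' + lam / n * memPot g ω (meanLip Lip) (ω + 1 / 2) σ') +
    ENNReal.ofReal (c * ‖σ'.H‖ ^ 2)) (by fun_prop)]
  -- `G` bounds the integrand, and `G1` its mean over the compression noises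
  set G : (Fin n → Fin b → Fin m) → (Fin n → Ξ) → ℝ := fun B ξ =>
    f σ.S - w + lam * ‖nextH g Q B ξ σ - meanField g σ.S‖ ^ 2 +
      lam * (r * ‖(n : ℝ)⁻¹ • ∑ i, nextErr g B σ i‖ ^ 2) +
      lam / n * (2 * (1 + ω) * ((ω + 1 / 2) *
        avgSq (memGap (step g Q (1 / (1 + ω)) γ B ξ σ)) +
        2 * ω * (1 + 2 * ω) * avgSq (nextErr g B σ))) with hG
  set G1 : (Fin n → Fin b → Fin m) → ℝ := fun B =>
    f σ.S - w + lam * ((r + 1) * ‖(n : ℝ)⁻¹ • ∑ i, nextErr g B σ i‖ ^ 2) +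
      lam / n * (2 * (1 + ω) * (ω * avgSq (residual g B σ) +
        2 * ω * (1 + 2 * ω) * avgSq (nextErr g B σ))) with hG1
  have hfw : 0 ≤ f σ.S - w := sub_nonneg.2 (hw _)
  have hG0 : ∀ B ξ, 0 ≤ G B ξ := fun B ξ => by
    have h1 := avgSq_nonneg (nextErr g B σ)
    have h2 := avgSq_nonneg (memGap (step g Q (1 / (1 + ω)) γ B ξ σ))
    simp only [hG]
    positivity
  have hG10 : ∀ B, 0 ≤ G1 B := fun B => by
    have h1 := avgSq_nonneg (nextErr g B σ)
    have h2 := avgSq_nonneg (residual g B σ)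
    simp only [hG1]
    positivity
  have hpoint : ∀ B ξ, ENNReal.ofReal (f (step g Q (1 / (1 + ω)) γ B ξ σ).S - w +
        lam * errPot g κ r (step g Q (1 / (1 + ω)) γ B ξ σ) +
        lam / n * memPot g ω (meanLip Lip) (ω + 1 / 2) (step g Q (1 / (1 + ω)) γ B ξ σ)) +
      ENNReal.ofReal (c * ‖(step g Q (1 / (1 + ω)) γ B ξ σ).H‖ ^ 2) ≤
      ENNReal.ofReal (G B ξ) := by
    intro B ξ
    have h1 := sub_nonneg.2 (hw (step g Q (1 / (1 + ω)) γ B ξ σ).S)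
    have h2 := errPot_nonneg (g := g) hκ0 hr (step g Q (1 / (1 + ω)) γ B ξ σ)
    have h3 := memPot_nonneg (g := g) (L := meanLip Lip) (δ := ω + 1 / 2) hω (by positivity)
      (step g Q (1 / (1 + ω)) γ B ξ σ)
    rw [← ENNReal.ofReal_add (by positivity) (by positivity)]
    refine ENNReal.ofReal_le_ofReal ?_
    have h4 := hdesc σ.S (nextH g Q B ξ σ)
    have hS : (step g Q (1 / (1 + ω)) γ B ξ σ).S = σ.S + γ • nextH g Q B ξ σ := rfl
    have h5 := mul_le_mul_of_nonneg_right hc (sq_nonneg ‖nextH g Q B ξ σ‖)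
    simp only [errPot, memPot, hG]
    rw [norm_move_step_sq, statErr_step, meanErr_step, step_H, hS]
    linarith
  have hGint : ∀ B, Integrable (G B) (Measure.pi fun _ => ν) ∧
      ∫ ξ, G B ξ ∂(Measure.pi fun _ => ν) ≤ G1 B := by
    intro B
    have i1 : Integrable (fun ξ => ‖nextH g Q B ξ σ - meanField g σ.S‖ ^ 2)
        (Measure.pi fun _ => ν) :=
      ((memLp_nextH hQ B hV).sub (memLp_const _)).norm.integrable_sq
    have i2 : Integrable (fun ξ => avgSq (memGap (step g Q (1 / (1 + ω)) γ B ξ σ)))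
        (Measure.pi fun _ => ν) :=
      (integrable_finsetSum _ fun i _ => integrable_memGap_step_sq hQ γ B σ i).const_mul _
    have e : G B = fun ξ => (lam * ‖nextH g Q B ξ σ - meanField g σ.S‖ ^ 2 +
        lam / n * (2 * (1 + ω) * (ω + 1 / 2)) *
          avgSq (memGap (step g Q (1 / (1 + ω)) γ B ξ σ))) +
        (f σ.S - w + lam * (r * ‖(n : ℝ)⁻¹ • ∑ i, nextErr g B σ i‖ ^ 2) +
          lam / n * (2 * (1 + ω) * (2 * ω * (1 + 2 * ω) * avgSq (nextErr g B σ)))) := by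
      funext ξ
      simp only [hG]
      ring
    have i3 : Integrable (fun ξ => lam * ‖nextH g Q B ξ σ - meanField g σ.S‖ ^ 2 +
        lam / n * (2 * (1 + ω) * (ω + 1 / 2)) *
          avgSq (memGap (step g Q (1 / (1 + ω)) γ B ξ σ))) (Measure.pi fun _ => ν) :=
      (i1.const_mul lam).add (i2.const_mul (lam / n * (2 * (1 + ω) * (ω + 1 / 2))))
    rw [e]
    refine ⟨i3.add (integrable_const _), ?_⟩
    rw [integral_add i3 (integrable_const _), integral_add (i1.const_mul lam) (i2.const_mul _),
      integral_const_mul, integral_const_mul, integral_const, probReal_univ, one_smul]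
    have j1 := mul_le_mul_of_nonneg_left (integral_nextH_sub_sq_le (g := g) hQ B hV) hlam
    have j2 := mul_le_mul_of_nonneg_left (integral_avgSq_memGap_step_le (g := g) hQ γ B σ)
      (by positivity : 0 ≤ lam / n * (2 * (1 + ω) * (ω + 1 / 2)))
    have j3 : lam / n * (2 * (1 + ω) * (ω + 1 / 2)) * (ω / (1 + ω) * avgSq (residual g B σ)) =
        lam / n * (2 * (ω + 1 / 2) * ω * avgSq (residual g B σ)) := by
      field_simp
    have j4 : lam * (ω / n * avgSq (residual g B σ)) =
        lam / n * (ω * avgSq (residual g B σ)) := by ring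
    rw [j3] at j2
    rw [mul_add, j4] at j1
    simp only [hG1]
    linarith
  calc _ ≤ ∫⁻ B, ENNReal.ofReal (G1 B) ∂(Measure.pi fun _ => batchLaw b m sch) :=
        lintegral_mono fun B => (lintegral_mono fun ξ => hpoint B ξ).trans
          (lintegral_ofReal_le (hGint B).1 (hG0 B) (hGint B).2)
    _ ≤ _ := by
        refine lintegral_ofReal_le .of_finite hG10 ?_
        have k1 := integral_mean_nextErr_sq_le hLip hb hm sch hn σ
        have k2 := integral_avgSq_nextErr_le hLip hb hm sch σ
        have k3 : ω * ∫ B : Fin n → Fin b → Fin m, avgSq (residual g B σ)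
              ∂(Measure.pi fun _ => batchLaw b m sch) ≤
            δ * avgSq (memGap σ) +
              ω * (1 + 2 * ω) * (meanLip Lip ^ 2 * ‖σ.S - σ.Sprev‖ ^ 2) := by
          rcases hδ with rfl | ⟨rfl, hd⟩
          · exact mul_integral_avgSq_residual_le hLip hb hm sch hω σ
          · have : ∀ B : Fin n → Fin b → Fin m, residual g B σ = memGap σ := fun B =>
              funext fun i => residual_eq_memGap hb B hd i
            simp [this, hd]
        have e : G1 = fun B => (f σ.S - w) +
            (lam * (r + 1) * ‖(n : ℝ)⁻¹ • ∑ i, nextErr g B σ i‖ ^ 2 +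
              (lam / n * (2 * (1 + ω)) * (ω * avgSq (residual g B σ)) +
              lam / n * (2 * (1 + ω)) * (2 * ω * (1 + 2 * ω)) * avgSq (nextErr g B σ))) := by
          funext B
          simp only [hG1]
          ring
        rw [e, integral_add .of_finite .of_finite, integral_add .of_finite .of_finite,
          integral_add .of_finite .of_finite, integral_const_mul, integral_const_mul,
          integral_const_mul, integral_const_mul, integral_const, probReal_univ, one_smul]
        have l1 := mul_le_mul_of_nonneg_left k1 (by positivity : 0 ≤ lam * (r + 1))
        have l2 := mul_le_mul_of_nonneg_left k2
          (by positivity : 0 ≤ lam / n * (2 * (1 + ω)) * (2 * ω * (1 + 2 * ω)))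
        have l3 := mul_le_mul_of_nonneg_left k3 (by positivity : 0 ≤ lam / n * (2 * (1 + ω)))
        have l4 : meanLip Lip ^ 2 / b * ‖σ.S - σ.Sprev‖ ^ 2 ≤
            meanLip Lip ^ 2 * ‖σ.S - σ.Sprev‖ ^ 2 := by
          gcongr
          exact div_le_self (sq_nonneg _) hb1
        have l5 := mul_le_mul_of_nonneg_left l4
          (by positivity : 0 ≤ lam / n * (2 * (1 + ω)) * (2 * ω * (1 + 2 * ω)))
        simp only [errPot, memPot, hκ]
        linarith

include hQ hg hLip hn hb hm in
/-- The mini-batch errors accumulate like a martingale: their potential pays for the square of the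
current error, at the price of a multiple of the square of the move. -/
theorem lintegral_errPot_step_le {γ r κ : ℝ} (hr : 0 ≤ r) (hκ : κ = meanLip Lip ^ 2 / (n * b))
    (σ : State n q) :
    ∫⁻ z, (ENNReal.ofReal (errPot g κ r (step g Q (1 / (1 + ω)) γ z.1 z.2 σ)) +
        ENNReal.ofReal (‖meanErr g (step g Q (1 / (1 + ω)) γ z.1 z.2 σ)‖ ^ 2))
      ∂(noiseLaw n b m sch ν) ≤
    ENNReal.ofReal (errPot g κ (r + 1) σ) + ENNReal.ofReal (r * κ * γ ^ 2) *
      ∫⁻ z, ENNReal.ofReal (‖(step g Q (1 / (1 + ω)) γ z.1 z.2 σ).H‖ ^ 2)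
        ∂(noiseLaw n b m sch ν) := by
  have hκ0 : 0 ≤ κ := by rw [hκ]; positivity
  have hmF := measurable_errPot hg κ r
  have hmE := measurable_meanErr hg
  rw [lintegral_noiseLaw hQ hg sch (F := fun σ' => ENNReal.ofReal (errPot g κ r σ') +
    ENNReal.ofReal (‖meanErr g σ'‖ ^ 2)) (by fun_prop),
    lintegral_noiseLaw hQ hg sch (F := fun σ' => ENNReal.ofReal (‖σ'.H‖ ^ 2)) (by fun_prop)]
  have hpoint : ∀ (B : Fin n → Fin b → Fin m) ξ,
      ENNReal.ofReal (errPot g κ r (step g Q (1 / (1 + ω)) γ B ξ σ)) +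
      ENNReal.ofReal (‖meanErr g (step g Q (1 / (1 + ω)) γ B ξ σ)‖ ^ 2) =
      ENNReal.ofReal ((r + 1) * ‖(n : ℝ)⁻¹ • ∑ i, nextErr g B σ i‖ ^ 2) +
      ENNReal.ofReal (r * κ * γ ^ 2) *
        ENNReal.ofReal (‖(step g Q (1 / (1 + ω)) γ B ξ σ).H‖ ^ 2) := by
    intro B ξ
    rw [← ENNReal.ofReal_mul (by positivity),
      ← ENNReal.ofReal_add (errPot_nonneg hκ0 hr _) (by positivity),
      ← ENNReal.ofReal_add (by positivity) (by positivity)]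
    congr 1
    simp only [errPot]
    rw [norm_move_step_sq, meanErr_step, step_H]
    ring
  simp only [hpoint]
  simp_rw [lintegral_add_left measurable_const]
  rw [lintegral_add_left .of_discrete]
  simp_rw [lintegral_const_mul' _ _ ENNReal.ofReal_ne_top]
  gcongr
  simp only [lintegral_const, measure_univ, mul_one]
  refine lintegral_ofReal_le .of_finite (fun B => by positivity) ?_
  rw [integral_const_mul]
  have k1 := integral_mean_nextErr_sq_le hLip hb hm sch hn σ
  simp only [errPot, hκ]
  gcongr

include hQ hg in
/-- Given the mini-batches, the field is an unbiased estimate of the mean field plus the mini-batch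
error, so that its mean square dominates the square of that sum. -/
theorem norm_meanField_sq_le_lintegral {γ : ℝ} {σ : State n q}
    (hV : σ.V = (n : ℝ)⁻¹ • ∑ i, σ.Vloc i) :
    ENNReal.ofReal (‖meanField g σ.S‖ ^ 2) ≤
      2 * ∫⁻ z, ENNReal.ofReal (‖(step g Q (1 / (1 + ω)) γ z.1 z.2 σ).H‖ ^ 2)
        ∂(noiseLaw n b m sch ν) +
      2 * ∫⁻ z, ENNReal.ofReal (‖meanErr g (step g Q (1 / (1 + ω)) γ z.1 z.2 σ)‖ ^ 2)
        ∂(noiseLaw n b m sch ν) := by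
  have hmE := measurable_meanErr hg
  rw [lintegral_noiseLaw hQ hg sch (F := fun σ' => ENNReal.ofReal (‖meanErr g σ'‖ ^ 2))
      (by fun_prop),
    lintegral_noiseLaw hQ hg sch (F := fun σ' => ENNReal.ofReal (‖σ'.H‖ ^ 2)) (by fun_prop),
    ← lintegral_const_mul' _ _ (by simp), ← lintegral_const_mul' _ _ (by simp),
    ← lintegral_add_left .of_discrete]
  have hB : ∀ B : Fin n → Fin b → Fin m, ENNReal.ofReal (‖meanField g σ.S‖ ^ 2) ≤
      2 * ∫⁻ ξ, ENNReal.ofReal (‖(step g Q (1 / (1 + ω)) γ B ξ σ).H‖ ^ 2)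
        ∂(Measure.pi fun _ => ν) +
      2 * ∫⁻ ξ, ENNReal.ofReal (‖meanErr g (step g Q (1 / (1 + ω)) γ B ξ σ)‖ ^ 2)
        ∂(Measure.pi fun _ => ν) := by
    intro B
    have h := ENNReal.ofReal_le_ofReal (norm_meanField_sq_le (g := g) hQ B hV)
    have hI : 0 ≤ ∫ ξ, ‖nextH g Q B ξ σ‖ ^ 2 ∂(Measure.pi fun _ => ν) :=
      integral_nonneg fun ξ => sq_nonneg _
    rw [ENNReal.ofReal_add (by positivity) (by positivity), ENNReal.ofReal_mul (by norm_num),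
      ENNReal.ofReal_mul (by norm_num), ofReal_integral_eq_lintegral_ofReal
        (memLp_nextH hQ B hV).norm.integrable_sq
        (Filter.Eventually.of_forall fun ξ => sq_nonneg _)] at h
    refine h.trans (le_of_eq ?_)
    simp [meanErr_step, step_H]
  calc ENNReal.ofReal (‖meanField g σ.S‖ ^ 2)
      = ∫⁻ _ : Fin n → Fin b → Fin m, ENNReal.ofReal (‖meanField g σ.S‖ ^ 2)
          ∂(Measure.pi fun _ => batchLaw b m sch) := by simp
    _ ≤ _ := lintegral_mono hB

end OneStep

/-! ### The path of the algorithm and its past -/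

section Path

variable {n m q b : ℕ} {Ω Ξ : Type*}

/-- The state after `k` inner iterations of outer loop `t`, as a random variable; worker `i` starts
with the memory `v₀ i (Sinit x)`. -/
noncomputable def path (g : Fin n → Fin m → Vec q → Vec q) (Q : Ξ → Vec q → Vec q) (α γ : ℝ)
    (kin : ℕ) (Sinit : Ω → Vec q) (v₀ : Fin n → Vec q → Vec q)
    (B : ℕ → ℕ → Fin n → Ω → Fin b → Fin m) (ξ : ℕ → ℕ → Fin n → Ω → Ξ) (t k : ℕ) (x : Ω) :
    State n q :=
  run g Q α (fun _ _ => γ) kin (Sinit x) (fun i => v₀ i (Sinit x)) (fun t k i => B t k i x)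
    (fun t k i => ξ t k i x) t k

variable (g : Fin n → Fin m → Vec q → Vec q) (Q : Ξ → Vec q → Vec q) (α γ : ℝ) (kin : ℕ)
  (Sinit : Ω → Vec q) (v₀ : Fin n → Vec q → Vec q) (B : ℕ → ℕ → Fin n → Ω → Fin b → Fin m)
  (ξ : ℕ → ℕ → Fin n → Ω → Ξ)

theorem path_zero_zero (x : Ω) : path g Q α γ kin Sinit v₀ B ξ 0 0 x =
    initState g (Sinit x) fun i => v₀ i (Sinit x) := rfl

theorem path_restart (t : ℕ) (x : Ω) : path g Q α γ kin Sinit v₀ B ξ (t + 1) 0 x =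
    restart g (path g Q α γ kin Sinit v₀ B ξ t kin x) := rfl

theorem path_succ (t k : ℕ) (x : Ω) : path g Q α γ kin Sinit v₀ B ξ t (k + 1) x =
    step g Q α γ (fun i => B t k i x) (fun i => ξ t k i x)
      (path g Q α γ kin Sinit v₀ B ξ t k x) := rfl

/-- A property of the states holds along the path if the initialization, the restarts and the
iterations preserve it. -/
theorem path_induction {p : ℕ → ℕ → Prop} {kout : ℕ} (h0 : p 0 0)
    (hrestart : ∀ t, t + 1 < kout → p t kin → p (t + 1) 0)
    (hsucc : ∀ t < kout, ∀ k < kin, p t k → p t (k + 1)) :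
    ∀ t < kout, ∀ k ≤ kin, p t k := by
  have hin : ∀ t < kout, p t 0 → ∀ k ≤ kin, p t k := by
    intro t ht hp k
    induction k with
    | zero => exact fun _ => hp
    | succ k ih => exact fun hk => hsucc t ht k hk (ih (Nat.le_of_succ_le hk))
  intro t
  induction t with
  | zero => exact fun ht => hin 0 ht h0
  | succ t ih =>
    exact fun ht => hin (t + 1) ht (hrestart t ht (ih (Nat.lt_of_succ_lt ht) kin le_rfl))

/-- The memory of the server is the average of the memories of the workers. -/
theorem path_V (t k : ℕ) (hk : k ≤ kin) (x : Ω) :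
    (path g Q α γ kin Sinit v₀ B ξ t k x).V =
      (n : ℝ)⁻¹ • ∑ i, (path g Q α γ kin Sinit v₀ B ξ t k x).Vloc i := by
  refine path_induction (p := fun t k => (path g Q α γ kin Sinit v₀ B ξ t k x).V =
    (n : ℝ)⁻¹ • ∑ i, (path g Q α γ kin Sinit v₀ B ξ t k x).Vloc i) (kout := t + 1) kin rfl
    (fun t _ h => h) (fun t _ k _ h => ?_) t t.lt_succ_self k hk
  simp only [path_succ, step]
  rw [h, Finset.sum_add_distrib, smul_add, ← Finset.smul_sum, smul_comm α]

theorem path_start_S (t : ℕ) (x : Ω) : (path g Q α γ kin Sinit v₀ B ξ t 0 x).S =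
    (path g Q α γ kin Sinit v₀ B ξ t 0 x).Sprev := by
  cases t <;> rfl

theorem statErr_path_start (t : ℕ) (x : Ω) :
    statErr g (path g Q α γ kin Sinit v₀ B ξ t 0 x) = 0 := by
  funext i
  cases t <;> exact sub_self _

theorem errPot_path_start (κ r : ℝ) (t : ℕ) (x : Ω) :
    errPot g κ r (path g Q α γ kin Sinit v₀ B ξ t 0 x) = 0 := by
  simp [errPot, meanErr, statErr_path_start, path_start_S]

end Path

section Past

variable {n m q b kout kin : ℕ} {Ω Ξ : Type*} [MeasurableSpace Ω] [MeasurableSpace Ξ]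

/-- The sources of randomness which are used before iteration `k` of outer loop `t`. -/
def Source.IsBefore (t k : ℕ) : Source kout kin n → Prop
  | .init => True
  | .batch t' k' _ => t' < t ∨ (t' : ℕ) = t ∧ k' < k
  | .quant t' k' _ => t' < t ∨ (t' : ℕ) = t ∧ k' < k

/-- The mini-batches of iteration `k` of outer loop `t`. -/
def Source.IsBatchAt (t k : ℕ) : Source kout kin n → Prop
  | .batch t' k' _ => (t' : ℕ) = t ∧ (k' : ℕ) = k
  | _ => False

/-- The compression noises of iteration `k` of outer loop `t`. -/
def Source.IsQuantAt (t k : ℕ) : Source kout kin n → Prop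
  | .quant t' k' _ => (t' : ℕ) = t ∧ (k' : ℕ) = k
  | _ => False

variable (kout kin) in
/-- The σ-algebra generated by a set of sources of randomness. -/
@[reducible] def sigmaOf (Sinit : Ω → Vec q) (B : ℕ → ℕ → Fin n → Ω → Fin b → Fin m)
    (ξ : ℕ → ℕ → Fin n → Ω → Ξ) (A : Source kout kin n → Prop) : MeasurableSpace Ω :=
  ⨆ s ∈ {s | A s}, sourceSigma kout kin Sinit B ξ s

variable {Sinit : Ω → Vec q} {B : ℕ → ℕ → Fin n → Ω → Fin b → Fin m}
  {ξ : ℕ → ℕ → Fin n → Ω → Ξ}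

omit [MeasurableSpace Ω] [MeasurableSpace Ξ] in
theorem measurable_of_components {m' : MeasurableSpace Ω} {β : Type*} [MeasurableSpace β]
    {f : Fin n → Ω → β} (hf : ∀ i, Measurable (f i)) : Measurable fun x i => f i x :=
  measurable_pi_iff.2 hf

omit [MeasurableSpace Ω] in
theorem sigmaOf_mono {A A' : Source kout kin n → Prop} (h : ∀ s, A s → A' s) :
    sigmaOf kout kin Sinit B ξ A ≤ sigmaOf kout kin Sinit B ξ A' :=
  biSup_mono h

omit [MeasurableSpace Ω] in
theorem measurable_init_sigmaOf {A : Source kout kin n → Prop} (h : A .init) :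
    Measurable[sigmaOf kout kin Sinit B ξ A] Sinit :=
  (comap_measurable Sinit).mono
    (le_iSup₂ (f := fun s (_ : s ∈ {s | A s}) => sourceSigma kout kin Sinit B ξ s)
      Source.init h) le_rfl

omit [MeasurableSpace Ω] in
theorem measurable_batch_sigmaOf {A : Source kout kin n → Prop} {t : Fin kout} {k : Fin kin}
    {i : Fin n} (h : A (.batch t k i)) : Measurable[sigmaOf kout kin Sinit B ξ A] (B t k i) :=
  (comap_measurable (B t k i)).mono
    (le_iSup₂ (f := fun s (_ : s ∈ {s | A s}) => sourceSigma kout kin Sinit B ξ s)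
      (Source.batch t k i) h) le_rfl

omit [MeasurableSpace Ω] in
theorem measurable_quant_sigmaOf {A : Source kout kin n → Prop} {t : Fin kout} {k : Fin kin}
    {i : Fin n} (h : A (.quant t k i)) : Measurable[sigmaOf kout kin Sinit B ξ A] (ξ t k i) :=
  (comap_measurable (ξ t k i)).mono
    (le_iSup₂ (f := fun s (_ : s ∈ {s | A s}) => sourceSigma kout kin Sinit B ξ s)
      (Source.quant t k i) h) le_rfl

omit [MeasurableSpace Ω] in
/-- The state of the algorithm is a function of the past. -/
theorem measurable_path_past {g : Fin n → Fin m → Vec q → Vec q} {Q : Ξ → Vec q → Vec q}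
    (hg : ∀ i j, Measurable (g i j)) (hQ : Measurable (Function.uncurry Q)) (α γ : ℝ)
    {v₀ : Fin n → Vec q → Vec q} (hv₀ : ∀ i, Measurable (v₀ i)) :
    ∀ t < kout, ∀ k ≤ kin, Measurable[sigmaOf kout kin Sinit B ξ (Source.IsBefore t k)]
      (path g Q α γ kin Sinit v₀ B ξ t k) := by
  refine path_induction kin ?_ (fun t _ h => ?_) (fun t ht k hk h => ?_)
  · have h1 : Measurable[sigmaOf kout kin Sinit B ξ (Source.IsBefore 0 0)] Sinit :=
      measurable_init_sigmaOf trivial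
    exact (measurable_initState hg).comp
      (h1.prodMk (measurable_of_components fun i => (hv₀ i).comp h1))
  · refine ((measurable_restart hg).comp h).mono (sigmaOf_mono fun s hs => ?_) le_rfl
    cases s <;> simp only [Source.IsBefore] at hs ⊢ <;> omega
  · have h1 : Measurable[sigmaOf kout kin Sinit B ξ (Source.IsBefore t (k + 1))]
        (path g Q α γ kin Sinit v₀ B ξ t k) :=
      h.mono (sigmaOf_mono fun s hs => by
        cases s <;> simp only [Source.IsBefore] at hs ⊢ <;> omega) le_rfl
    have h2 : Measurable[sigmaOf kout kin Sinit B ξ (Source.IsBefore t (k + 1))]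
        (fun x i => B t k i x) :=
      measurable_of_components fun i => measurable_batch_sigmaOf (t := ⟨t, ht⟩) (k := ⟨k, hk⟩)
        (Or.inr ⟨rfl, k.lt_succ_self⟩)
    have h3 : Measurable[sigmaOf kout kin Sinit B ξ (Source.IsBefore t (k + 1))]
        (fun x i => ξ t k i x) :=
      measurable_of_components fun i => measurable_quant_sigmaOf (t := ⟨t, ht⟩) (k := ⟨k, hk⟩)
        (Or.inr ⟨rfl, k.lt_succ_self⟩)
    exact (measurable_step hg hQ α γ).comp (h1.prodMk (h2.prodMk h3))

variable {P : Measure Ω} [IsProbabilityMeasure P] {ν : Measure Ξ} {sch : Sampling}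
  (hinput : IsRandomInput P ν sch kout kin Sinit B ξ)
include hinput

omit [IsProbabilityMeasure P] in
theorem IsRandomInput.sourceSigma_le (s : Source kout kin n) :
    sourceSigma kout kin Sinit B ξ s ≤ ‹MeasurableSpace Ω› := by
  cases s with
  | init => exact hinput.measurable_init.comap_le
  | batch t k i => exact (hinput.measurable_batch t k i).comap_le
  | quant t k i => exact (hinput.measurable_quant t k i).comap_le

omit [IsProbabilityMeasure P] in
theorem IsRandomInput.sigmaOf_le (A : Source kout kin n → Prop) :
    sigmaOf kout kin Sinit B ξ A ≤ ‹MeasurableSpace Ω› :=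
  iSup₂_le fun s _ => hinput.sourceSigma_le s

omit [IsProbabilityMeasure P] in
theorem IsRandomInput.indepFun {A A' : Source kout kin n → Prop} (hAA' : ∀ s, A s → ¬ A' s)
    {𝓧 𝓨 : Type*} [MeasurableSpace 𝓧] [MeasurableSpace 𝓨] {X : Ω → 𝓧} {Y : Ω → 𝓨}
    (hX : Measurable[sigmaOf kout kin Sinit B ξ A] X)
    (hY : Measurable[sigmaOf kout kin Sinit B ξ A'] Y) : IndepFun X Y P := by
  have h := indep_iSup_of_disjoint hinput.sourceSigma_le hinput.indep
    (S := {s | A s}) (T := {s | A' s}) (Set.disjoint_left.2 hAA')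
  exact (IndepFun_iff_Indep _ _ _).2
    (indep_of_indep_of_le_left (indep_of_indep_of_le_right h hY.comap_le) hX.comap_le)

theorem IsRandomInput.map_noise (t : Fin kout) (k : Fin kin) :
    P.map (fun x => ((fun i => B t k i x), (fun i => ξ t k i x))) = noiseLaw n b m sch ν := by
  have hB : P.map (fun x i => B t k i x) = Measure.pi fun _ => batchLaw b m sch := by
    have hind : iIndepFun (fun i => B t k i) P :=
      hinput.indep.precomp (g := fun i => Source.batch t k i) fun i j h => by
        injection h
    rw [(iIndepFun_iff_map_fun_eq_pi_map fun i =>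
      (hinput.measurable_batch t k i).aemeasurable).1 hind]
    simp only [hinput.law_batch]
  have hξ : P.map (fun x i => ξ t k i x) = Measure.pi fun _ => ν := by
    have hind : iIndepFun (fun i => ξ t k i) P :=
      hinput.indep.precomp (g := fun i => Source.quant t k i) fun i j h => by
        injection h
    rw [(iIndepFun_iff_map_fun_eq_pi_map fun i =>
      (hinput.measurable_quant t k i).aemeasurable).1 hind]
    simp only [hinput.law_quant]
  have hind : IndepFun (fun x i => B t k i x) (fun x i => ξ t k i x) P :=
    hinput.indepFun (A := Source.IsBatchAt t k) (A' := Source.IsQuantAt t k)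
      (fun s => by cases s <;> simp [Source.IsBatchAt, Source.IsQuantAt])
      (measurable_of_components fun i => measurable_batch_sigmaOf ⟨rfl, rfl⟩)
      (measurable_of_components fun i => measurable_quant_sigmaOf ⟨rfl, rfl⟩)
  rw [(indepFun_iff_map_prod_eq_prod_map_map
    (measurable_of_components fun i => hinput.measurable_batch t k i).aemeasurable
    (measurable_of_components fun i => hinput.measurable_quant t k i).aemeasurable).1 hind, hB, hξ,
    noiseLaw]

/-- Freezing lemma: the noise of an iteration is independent of the current state. -/
theorem IsRandomInput.lintegral_path_succ [IsProbabilityMeasure ν]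
    [IsProbabilityMeasure (batchLaw b m sch)]
    {g : Fin n → Fin m → Vec q → Vec q} {Q : Ξ → Vec q → Vec q}
    (hg : ∀ i j, Measurable (g i j)) (hQ : Measurable (Function.uncurry Q)) (α γ : ℝ)
    {v₀ : Fin n → Vec q → Vec q} (hv₀ : ∀ i, Measurable (v₀ i)) (t : Fin kout) (k : Fin kin)
    {F : State n q → ENNReal} (hF : Measurable F) :
    ∫⁻ x, F (path g Q α γ kin Sinit v₀ B ξ t (k + 1) x) ∂P =
      ∫⁻ x, ∫⁻ z, F (step g Q α γ z.1 z.2 (path g Q α γ kin Sinit v₀ B ξ t k x))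
        ∂(noiseLaw n b m sch ν) ∂P := by
  have hpast := measurable_path_past (Sinit := Sinit) (B := B) (ξ := ξ) hg hQ α γ hv₀ t t.2 k
    k.2.le
  have hpath : Measurable (path g Q α γ kin Sinit v₀ B ξ t k) :=
    hpast.mono (hinput.sigmaOf_le _) le_rfl
  have hnoise : Measurable (fun x => ((fun i => B t k i x), (fun i => ξ t k i x))) :=
    (measurable_of_components fun i => hinput.measurable_batch t k i).prodMk
      (measurable_of_components fun i => hinput.measurable_quant t k i)
  have hind : IndepFun (path g Q α γ kin Sinit v₀ B ξ t k)
      (fun x => ((fun i => B t k i x), (fun i => ξ t k i x))) P := by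
    refine hinput.indepFun (A := Source.IsBefore t k)
      (A' := fun s => Source.IsBatchAt t k s ∨ Source.IsQuantAt t k s) (fun s => ?_) hpast
      ((measurable_of_components fun i => measurable_batch_sigmaOf (Or.inl ⟨rfl, rfl⟩)).prodMk
        (measurable_of_components fun i => measurable_quant_sigmaOf (Or.inr ⟨rfl, rfl⟩)))
    cases s <;> simp only [Source.IsBefore, Source.IsBatchAt, Source.IsQuantAt, or_false,
      false_or, not_false_eq_true, implies_true] <;> omega
  have hprod := (indepFun_iff_map_prod_eq_prod_map_map hpath.aemeasurable
    hnoise.aemeasurable).1 hind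
  rw [hinput.map_noise] at hprod
  have hFstep : Measurable fun p : State n q × (Fin n → Fin b → Fin m) × (Fin n → Ξ) =>
      F (step g Q α γ p.2.1 p.2.2 p.1) := hF.comp (measurable_step hg hQ α γ)
  have : SFinite (noiseLaw n b m sch ν) := by
    unfold noiseLaw
    infer_instance
  calc ∫⁻ x, F (path g Q α γ kin Sinit v₀ B ξ t (k + 1) x) ∂P
      = ∫⁻ p, F (step g Q α γ p.2.1 p.2.2 p.1) ∂(P.map fun x =>
          (path g Q α γ kin Sinit v₀ B ξ t k x, ((fun i => B t k i x), (fun i => ξ t k i x)))) :=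
        (lintegral_map hFstep (hpath.prodMk hnoise)).symm
    _ = ∫⁻ σ, ∫⁻ z, F (step g Q α γ z.1 z.2 σ) ∂(noiseLaw n b m sch ν)
          ∂(P.map (path g Q α γ kin Sinit v₀ B ξ t k)) := by
        rw [hprod, lintegral_prod _ hFstep.aemeasurable]
    _ = _ := lintegral_map hFstep.lintegral_prod_right' hpath

end Past

/-! ### Telescoping and the random time -/

/-- Telescoping over the inner iterations and the outer loops. -/
theorem sum_le_of_potential {kout kin : ℕ} {p a c : ℕ → ℕ → ENNReal}
    (hstep : ∀ t < kout, ∀ k < kin, p t (k + 1) + a t k ≤ p t k + c t k)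
    (hrestart : ∀ t, t + 1 < kout → p (t + 1) 0 ≤ p t kin) :
    ∑ t ∈ Finset.range kout, ∑ k ∈ Finset.range kin, a t k ≤
      p 0 0 + ∑ t ∈ Finset.range kout, ∑ k ∈ Finset.range kin, c t k := by
  have hin : ∀ t < kout, ∀ K ≤ kin, p t K + ∑ k ∈ Finset.range K, a t k ≤
      p t 0 + ∑ k ∈ Finset.range K, c t k := by
    intro t ht K
    induction K with
    | zero => simp
    | succ K ih =>
      intro hK
      rw [Finset.sum_range_succ, Finset.sum_range_succ]
      calc p t (K + 1) + (∑ k ∈ Finset.range K, a t k + a t K)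
          = (p t (K + 1) + a t K) + ∑ k ∈ Finset.range K, a t k := by ring
        _ ≤ (p t K + c t K) + ∑ k ∈ Finset.range K, a t k := by
            gcongr ?_ + _
            exact hstep t ht K hK
        _ = (p t K + ∑ k ∈ Finset.range K, a t k) + c t K := by ring
        _ ≤ (p t 0 + ∑ k ∈ Finset.range K, c t k) + c t K := by
            gcongr ?_ + _
            exact ih (Nat.le_of_succ_le hK)
        _ = _ := by ring
  have hout : ∀ T < kout, p T kin + ∑ t ∈ Finset.range (T + 1), ∑ k ∈ Finset.range kin, a t k ≤
      p 0 0 + ∑ t ∈ Finset.range (T + 1), ∑ k ∈ Finset.range kin, c t k := by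
    intro T
    induction T with
    | zero => simpa using fun h => hin 0 h kin le_rfl
    | succ T ih =>
      intro hT
      rw [Finset.sum_range_succ, Finset.sum_range_succ _ (T + 1)]
      set A := ∑ t ∈ Finset.range (T + 1), ∑ k ∈ Finset.range kin, a t k
      set D := ∑ t ∈ Finset.range (T + 1), ∑ k ∈ Finset.range kin, c t k
      calc p (T + 1) kin + (A + ∑ k ∈ Finset.range kin, a (T + 1) k)
          = (p (T + 1) kin + ∑ k ∈ Finset.range kin, a (T + 1) k) + A := by ring
        _ ≤ (p (T + 1) 0 + ∑ k ∈ Finset.range kin, c (T + 1) k) + A := by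
            gcongr ?_ + A
            exact hin (T + 1) hT kin le_rfl
        _ ≤ (p T kin + ∑ k ∈ Finset.range kin, c (T + 1) k) + A := by
            gcongr
            exact hrestart T hT
        _ = (p T kin + A) + ∑ k ∈ Finset.range kin, c (T + 1) k := by ring
        _ ≤ (p 0 0 + D) + ∑ k ∈ Finset.range kin, c (T + 1) k := by
            gcongr ?_ + _
            exact ih (Nat.lt_of_succ_lt hT)
        _ = _ := by ring
  rcases Nat.eq_zero_or_pos kout with rfl | h
  · simp
  obtain ⟨T, rfl⟩ := Nat.exists_eq_succ_of_ne_zero h.ne'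
  exact le_add_self.trans (hout T T.lt_succ_self)

/-- The expectation of a process at an independent uniform index is the average over the
indices. -/
theorem lintegral_uniform_index {Ω ι 𝓨 : Type*} [MeasurableSpace Ω] {P : Measure Ω}
    [IsProbabilityMeasure P] [Fintype ι] [MeasurableSpace ι]
    [MeasurableSingletonClass ι] [MeasurableSpace 𝓨] {I : Ω → ι} {Y : Ω → 𝓨}
    (hI : Measurable I) (hY : Measurable Y) (hunif : P.map I = uniformOn Set.univ)
    (hind : IndepFun I Y P) {f : ι → 𝓨 → ENNReal} (hf : ∀ i, Measurable (f i)) :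
    ∫⁻ x, f (I x) (Y x) ∂P = (Fintype.card ι : ENNReal)⁻¹ * ∑ i, ∫⁻ x, f i (Y x) ∂P := by
  have hmeas : Measurable fun p : ι × 𝓨 => f p.1 p.2 := measurable_from_prod_countable_right hf
  have hprod := (indepFun_iff_map_prod_eq_prod_map_map hI.aemeasurable hY.aemeasurable).1 hind
  have h1 : ∫⁻ x, f (I x) (Y x) ∂P = ∫⁻ p, f p.1 p.2 ∂(P.map fun x => (I x, Y x)) :=
    (lintegral_map hmeas (hI.prodMk hY)).symm
  rw [h1, hprod, lintegral_prod _ hmeas.aemeasurable, hunif, uniformOn, ProbabilityTheory.cond,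
    Measure.restrict_univ, lintegral_smul_measure, lintegral_count, tsum_fintype]
  simp only [lintegral_map (hf _) hY, smul_eq_mul]
  congr 2
  simp [Measure.count_apply_finite _ Set.finite_univ]

/-! ### Restarts and initialization -/

section Restart

variable {n m q : ℕ} {g : Fin n → Fin m → Vec q → Vec q} {Lip : Fin n → Fin m → ℝ}

theorem errPot_restart (κ r : ℝ) (σ : State n q) : errPot g κ r (restart g σ) = 0 := by
  simp [errPot, meanErr, statErr, restart]

/-- A restart replaces the local statistics by a full pass; the resulting jump of the memory gaps is
paid for by the larger weights of the potential at the end of an outer loop. -/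
theorem memPot_restart_le (hm : 0 < m)
    (hLip : ∀ i j (s s' : Vec q), ‖(g i j s - s) - (g i j s' - s')‖ ≤ Lip i j * ‖s - s'‖)
    {ω : ℝ} (hω : 0 ≤ ω) (σ : State n q) :
    memPot g ω (meanLip Lip) ω (restart g σ) ≤ memPot g ω (meanLip Lip) (ω + 1 / 2) σ := by
  have h : ∀ i, ω * ‖memGap (restart g σ) i‖ ^ 2 ≤ (ω + 1 / 2) * ‖memGap σ i‖ ^ 2 +
      ω * (1 + 2 * ω) * (2 * ((m : ℝ)⁻¹ * ((∑ j, Lip i j ^ 2) * ‖σ.S - σ.Sprev‖ ^ 2)) +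
        2 * ‖statErr g σ i‖ ^ 2) := by
    intro i
    have h1 : memGap (restart g σ) i = memGap σ i +
        ((m : ℝ)⁻¹ • ∑ j, increment g σ i j - statErr g σ i) := by
      rw [mean_increment g hm]
      simp only [memGap, restart, statErr]
      abel
    rw [h1]
    refine (mul_norm_add_sq_le hω _ _).trans ?_
    gcongr
    set u := (m : ℝ)⁻¹ • ∑ j, increment g σ i j with hu
    have h2 : ‖u‖ ^ 2 ≤ (m : ℝ)⁻¹ * ((∑ j, Lip i j ^ 2) * ‖σ.S - σ.Sprev‖ ^ 2) := by
      refine (norm_inv_smul_sum_sq_le hm _).trans ?_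
      gcongr
      exact sum_norm_increment_sq_le hLip σ i
    have h3 : ‖u - statErr g σ i‖ ^ 2 ≤ (‖u‖ + ‖statErr g σ i‖) ^ 2 :=
      pow_le_pow_left₀ (norm_nonneg _) (norm_sub_le _ _) 2
    nlinarith [sq_nonneg (‖u‖ - ‖statErr g σ i‖)]
  have havg : ω * avgSq (memGap (restart g σ)) ≤ (ω + 1 / 2) * avgSq (memGap σ) +
      ω * (1 + 2 * ω) * (2 * (meanLip Lip ^ 2 * ‖σ.S - σ.Sprev‖ ^ 2) +
        2 * avgSq (statErr g σ)) := by
    unfold avgSq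
    rw [mul_left_comm, Finset.mul_sum]
    refine (mul_le_mul_of_nonneg_left (Finset.sum_le_sum fun i _ => h i)
      (by positivity : 0 ≤ (n : ℝ)⁻¹)).trans_eq ?_
    rw [meanLip_sq, Finset.sum_add_distrib, ← Finset.mul_sum, ← Finset.mul_sum,
      Finset.sum_add_distrib, ← Finset.mul_sum, ← Finset.mul_sum, ← Finset.mul_sum,
      ← Finset.sum_mul, ← Finset.mul_sum]
    ring
  have hS : ‖(restart g σ).S - (restart g σ).Sprev‖ = 0 := by simp [restart]
  have hE : avgSq (statErr g (restart g σ)) = 0 := by simp [avgSq, statErr, restart]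
  have hnn : 0 ≤ ω * (1 + 2 * ω) * (meanLip Lip ^ 2 * ‖σ.S - σ.Sprev‖ ^ 2) := by positivity
  unfold memPot
  rw [hS, hE]
  refine mul_le_mul_of_nonneg_left ?_ (by positivity)
  linarith

theorem memPot_initState (ω L δ : ℝ) (s : Vec q) :
    memPot g ω L δ (initState g s fun i => fullPass g s i - s) = 0 := by
  simp [memPot, avgSq, memGap, statErr, initState]

end Restart

/-! ### Summing over the iterations -/

section Total

variable {n m q b kout kin : ℕ} {Ω Ξ : Type*} [MeasurableSpace Ω] [MeasurableSpace Ξ]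
  {g : Fin n → Fin m → Vec q → Vec q} {Q : Ξ → Vec q → Vec q} {ω : ℝ} {ν : Measure Ξ}
  [IsProbabilityMeasure ν] (hQ : IsCompressor ν Q ω) (hg : ∀ i j, Measurable (g i j))
  {Lip : Fin n → Fin m → ℝ}
  (hLip : ∀ i j (s s' : Vec q), ‖(g i j s - s) - (g i j s' - s')‖ ≤ Lip i j * ‖s - s'‖)
  (hn : 0 < n) (hb : 0 < b) (hm : 0 < m) {sch : Sampling}
  [IsProbabilityMeasure (batchLaw b m sch)]
  {Sinit : Ω → Vec q} {B : ℕ → ℕ → Fin n → Ω → Fin b → Fin m}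
  {ξ : ℕ → ℕ → Fin n → Ω → Ξ} {P : Measure Ω} [IsProbabilityMeasure P]
  (hinput : IsRandomInput P ν sch kout kin Sinit B ξ) {γ κ : ℝ}
include hQ hg hLip hn hb hm hinput

/-- The potential telescopes within an outer loop and does not increase at a restart. At the initial
state, both error potentials vanish. -/
theorem sum_lintegral_H_sq_le (hkin : 0 < kin) {f : Vec q → ℝ} (hf : Measurable f)
    {w vmin vmax LW C c : ℝ} (hw : ∀ s, w ≤ f s) (hvmax : 0 ≤ vmax) (hC : 0 < C)
    (hdesc : ∀ s v, f (s + γ • v) ≤ f s + vmax / (2 * C) * ‖v - meanField g s‖ ^ 2 -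
      (γ * vmin - γ ^ 2 * (vmax * C / 2 + LW / 2)) * ‖v‖ ^ 2)
    (hκ : κ = meanLip Lip ^ 2 / (n * b)) (hc0 : 0 ≤ c)
    (hc : c + vmax / (2 * C) * (kin * κ) * γ ^ 2 +
      vmax / (2 * C) / n * (6 * ω * (1 + ω) * (1 + 2 * ω) * meanLip Lip ^ 2) * γ ^ 2 ≤
      γ * vmin - γ ^ 2 * (vmax * C / 2 + LW / 2)) :
    ENNReal.ofReal c * ∑ t ∈ Finset.range kout, ∑ k ∈ Finset.range kin,
      ∫⁻ x, ENNReal.ofReal (‖(path g Q (1 / (1 + ω)) γ kin Sinit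
        (fun i s => fullPass g s i - s) B ξ t (k + 1) x).H‖ ^ 2) ∂P ≤
      ∫⁻ x, ENNReal.ofReal (f (Sinit x) - w) ∂P := by
  have hω := hQ.omega_nonneg
  have hκ0 : 0 ≤ κ := by rw [hκ]; positivity
  have hv₀ : ∀ i, Measurable fun s : Vec q => fullPass g s i - s := fun i =>
    (measurable_fullPass hg i).sub measurable_id
  set lam := vmax / (2 * C) with hlam_def
  have hlam : 0 ≤ lam := by positivity
  set X := path g Q (1 / (1 + ω)) γ kin Sinit (fun i s => fullPass g s i - s) B ξ with hX
  set Φ : ℕ → State n q → ℝ := fun k σ => f σ.S - w + lam * errPot g κ (kin - k) σ +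
    lam / n * memPot g ω (meanLip Lip) (if k = 0 then ω else ω + 1 / 2) σ with hΦ
  have hΦm : ∀ k, Measurable (Φ k) := fun k => by
    have h1 := measurable_errPot hg κ (kin - k)
    have h2 := measurable_memPot hg ω (meanLip Lip) (if k = 0 then ω else ω + 1 / 2)
    simp only [hΦ]
    fun_prop
  have h := sum_le_of_potential (kout := kout) (kin := kin)
    (p := fun t k => ∫⁻ x, ENNReal.ofReal (Φ k (X t k x)) ∂P)
    (a := fun t k => ∫⁻ x, ENNReal.ofReal (c * ‖(X t (k + 1) x).H‖ ^ 2) ∂P) (c := fun _ _ => 0)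
    (fun t ht k hk => ?_) (fun t ht => ?_)
  · have h0 : ∀ x, Φ 0 (X 0 0 x) = f (Sinit x) - w := fun x => by
      simp only [hΦ, hX, errPot_path_start]
      rw [path_zero_zero, memPot_initState]
      simp [initState]
    simp only [h0, Finset.sum_const_zero, add_zero, ENNReal.ofReal_mul hc0] at h
    simp_rw [lintegral_const_mul' _ _ ENNReal.ofReal_ne_top] at h
    simpa only [Finset.mul_sum] using h
  · have hpath : Measurable (X t (k + 1)) :=
      (measurable_path_past hg hQ.measurable _ γ hv₀ t ht (k + 1) hk).mono
        (hinput.sigmaOf_le _) le_rfl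
    have hm1 := hΦm (k + 1)
    rw [add_zero, ← lintegral_add_left (by fun_prop)]
    rw [hinput.lintegral_path_succ hg hQ.measurable (1 / (1 + ω)) γ hv₀ ⟨t, ht⟩ ⟨k, hk⟩
      (F := fun σ => ENNReal.ofReal (Φ (k + 1) σ) + ENNReal.ofReal (c * ‖σ.H‖ ^ 2))
      (by fun_prop)]
    refine lintegral_mono fun x => ?_
    have hr : (0 : ℝ) ≤ kin - (k + 1 : ℕ) := sub_nonneg.2 (by exact_mod_cast hk)
    have hrk : (kin : ℝ) - (k + 1 : ℕ) ≤ kin := sub_le_self _ (Nat.cast_nonneg _)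
    have hstep := lintegral_potential_step_le hQ hg hLip hn hb hm sch hf hw hvmax hC hr hdesc hκ
      hc0 (c := c) (δ := if k = 0 then ω else ω + 1 / 2) (le_trans (by gcongr) hc)
      (path_V g Q (1 / (1 + ω)) γ kin Sinit (fun i s => fullPass g s i - s) B ξ t k hk.le x)
      (by
        rcases Nat.eq_zero_or_pos k with rfl | h
        · exact Or.inr ⟨if_pos rfl, path_start_S g Q (1 / (1 + ω)) γ kin Sinit _ B ξ t x⟩
        · exact Or.inl (if_neg h.ne'))
    have hrr : (kin : ℝ) - (k + 1 : ℕ) + 1 = kin - k := by push_cast; ring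
    rw [hrr] at hstep
    simpa only [hΦ, Nat.add_eq_zero_iff, one_ne_zero, and_false, if_false] using hstep
  · refine lintegral_mono fun x => ENNReal.ofReal_le_ofReal ?_
    have h1 := memPot_restart_le hm hLip hω (X t kin x)
    have h2 := mul_le_mul_of_nonneg_left h1 (by positivity : 0 ≤ lam / n)
    simp only [hΦ, hX, path_restart, errPot_restart, hkin.ne', if_true, if_false, sub_self]
    simp only [hX] at h2
    have h3 : ∀ σ : State n q, errPot g κ 0 σ = 0 := fun σ => by simp [errPot]
    have h4 : ∀ σ : State n q, (restart g σ).S = σ.S := fun σ => rfl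
    rw [h3, h4]
    linarith

theorem sum_lintegral_meanErr_sq_le (hκ : κ = meanLip Lip ^ 2 / (n * b)) :
    ∑ t ∈ Finset.range kout, ∑ k ∈ Finset.range kin,
      ∫⁻ x, ENNReal.ofReal (‖meanErr g (path g Q (1 / (1 + ω)) γ kin Sinit
        (fun i s => fullPass g s i - s) B ξ t (k + 1) x)‖ ^ 2) ∂P ≤
    ENNReal.ofReal (kin * κ * γ ^ 2) * ∑ t ∈ Finset.range kout, ∑ k ∈ Finset.range kin,
      ∫⁻ x, ENNReal.ofReal (‖(path g Q (1 / (1 + ω)) γ kin Sinit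
        (fun i s => fullPass g s i - s) B ξ t (k + 1) x).H‖ ^ 2) ∂P := by
  have hκ0 : 0 ≤ κ := by rw [hκ]; positivity
  have hv₀ : ∀ i, Measurable fun s : Vec q => fullPass g s i - s := fun i =>
    (measurable_fullPass hg i).sub measurable_id
  set X := path g Q (1 / (1 + ω)) γ kin Sinit (fun i s => fullPass g s i - s) B ξ with hX
  have h := sum_le_of_potential (kout := kout) (kin := kin)
    (p := fun t k => ∫⁻ x, ENNReal.ofReal (errPot g κ (kin - k) (X t k x)) ∂P)
    (a := fun t k => ∫⁻ x, ENNReal.ofReal (‖meanErr g (X t (k + 1) x)‖ ^ 2) ∂P)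
    (c := fun t k => ENNReal.ofReal (kin * κ * γ ^ 2) *
      ∫⁻ x, ENNReal.ofReal (‖(X t (k + 1) x).H‖ ^ 2) ∂P)
    (fun t ht k hk => ?_) (fun t ht => ?_)
  · simp only [hX, errPot_path_start, ENNReal.ofReal_zero, lintegral_zero, zero_add,
      ← Finset.mul_sum] at h
    exact h
  · have hpath : ∀ k ≤ kin, Measurable (X t k) := fun k hk =>
      (measurable_path_past hg hQ.measurable _ γ hv₀ t ht k hk).mono
        (hinput.sigmaOf_le _) le_rfl
    have hm1 := measurable_errPot hg κ (kin - (k + 1 : ℕ))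
    have hm2 := measurable_meanErr hg
    have hm3 : Measurable fun x => errPot g κ (kin - k) (X t k x) :=
      (measurable_errPot hg κ (kin - k)).comp (hpath k hk.le)
    have hm4 : Measurable fun x => errPot g κ (kin - (k + 1 : ℕ)) (X t (k + 1) x) :=
      hm1.comp (hpath (k + 1) hk)
    rw [← lintegral_add_left hm4.ennreal_ofReal]
    rw [hinput.lintegral_path_succ hg hQ.measurable (1 / (1 + ω)) γ hv₀ ⟨t, ht⟩ ⟨k, hk⟩
        (F := fun σ => ENNReal.ofReal (errPot g κ (kin - (k + 1 : ℕ)) σ) +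
          ENNReal.ofReal (‖meanErr g σ‖ ^ 2)) (by fun_prop),
      hinput.lintegral_path_succ hg hQ.measurable (1 / (1 + ω)) γ hv₀ ⟨t, ht⟩ ⟨k, hk⟩
        (F := fun σ => ENNReal.ofReal (‖σ.H‖ ^ 2)) (by fun_prop),
      ← lintegral_const_mul' _ _ ENNReal.ofReal_ne_top, ← lintegral_add_left hm3.ennreal_ofReal]
    refine lintegral_mono fun x => ?_
    have hr : (0 : ℝ) ≤ kin - (k + 1 : ℕ) := sub_nonneg.2 (by exact_mod_cast hk)
    have hrk : (kin : ℝ) - (k + 1 : ℕ) ≤ kin := sub_le_self _ (Nat.cast_nonneg _)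
    have hrr : (kin : ℝ) - (k + 1 : ℕ) + 1 = kin - k := by push_cast; ring
    have hstep := lintegral_errPot_step_le hQ hg hLip hn hb hm sch (γ := γ) hr hκ (X t k x)
    rw [hrr] at hstep
    refine hstep.trans ?_
    gcongr
  · simp [hX, path_restart, errPot_restart]

omit hLip hn hb hm in
theorem lintegral_meanField_sq_le {t k : ℕ} (ht : t < kout) (hk : k < kin) :
    ∫⁻ x, ENNReal.ofReal (‖meanField g (path g Q (1 / (1 + ω)) γ kin Sinit
        (fun i s => fullPass g s i - s) B ξ t k x).S‖ ^ 2) ∂P ≤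
    2 * ∫⁻ x, ENNReal.ofReal (‖(path g Q (1 / (1 + ω)) γ kin Sinit
        (fun i s => fullPass g s i - s) B ξ t (k + 1) x).H‖ ^ 2) ∂P +
    2 * ∫⁻ x, ENNReal.ofReal (‖meanErr g (path g Q (1 / (1 + ω)) γ kin Sinit
        (fun i s => fullPass g s i - s) B ξ t (k + 1) x)‖ ^ 2) ∂P := by
  have hv₀ : ∀ i, Measurable fun s : Vec q => fullPass g s i - s := fun i =>
    (measurable_fullPass hg i).sub measurable_id
  set X := path g Q (1 / (1 + ω)) γ kin Sinit (fun i s => fullPass g s i - s) B ξ with hX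
  have hpath : Measurable (X t (k + 1)) :=
    (measurable_path_past hg hQ.measurable _ γ hv₀ t ht (k + 1) hk).mono
      (hinput.sigmaOf_le _) le_rfl
  have hm2 := measurable_meanErr hg
  rw [← lintegral_const_mul' _ _ (by simp), ← lintegral_const_mul' _ _ (by simp),
    ← lintegral_add_left (by fun_prop)]
  rw [hinput.lintegral_path_succ hg hQ.measurable (1 / (1 + ω)) γ hv₀ ⟨t, ht⟩ ⟨k, hk⟩
    (F := fun σ => 2 * ENNReal.ofReal (‖σ.H‖ ^ 2) + 2 * ENNReal.ofReal (‖meanErr g σ‖ ^ 2))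
    (by fun_prop)]
  refine lintegral_mono fun x => ?_
  have h := norm_meanField_sq_le_lintegral (b := b) hQ hg sch (γ := γ) (σ := X t k x)
    (path_V g Q (1 / (1 + ω)) γ kin Sinit (fun i s => fullPass g s i - s) B ξ t k hk.le x)
  have hms : Measurable fun z : (Fin n → Fin b → Fin m) × (Fin n → Ξ) =>
      step g Q (1 / (1 + ω)) γ z.1 z.2 (X t k x) :=
    (measurable_step hg hQ.measurable _ γ).comp (measurable_const.prodMk measurable_id)
  have hmH : Measurable fun z : (Fin n → Fin b → Fin m) × (Fin n → Ξ) =>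
      2 * ENNReal.ofReal (‖(step g Q (1 / (1 + ω)) γ z.1 z.2 (X t k x)).H‖ ^ 2) :=
    ((measurable_H.comp hms).norm.pow_const 2).ennreal_ofReal.const_mul 2
  rw [← lintegral_const_mul' _ _ (by simp), ← lintegral_const_mul' _ _ (by simp),
    ← lintegral_add_left hmH] at h
  exact h

end Total

/-! ### The constants -/

/-- The objective decreases along a step `γ • v`, up to the distance of `v` to the mean field. -/
theorem Model.Lyapunov.descent {n m d q : ℕ} {Y Z : Type*} [MeasurableSpace Z]
    {M : Model n m d q Y Z} {hT : M.UniqueMStep} {LW vmin vmax : ℝ}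
    (hW : M.Lyapunov hT LW vmin vmax) {γ C : ℝ} (hγ : 0 < γ) (hC : 0 < C) (s v : Vec q) :
    M.W hT (s + γ • v) ≤ M.W hT s + vmax / (2 * C) * ‖v - M.h hT s‖ ^ 2 -
      (γ * vmin - γ ^ 2 * (vmax * C / 2 + LW / 2)) * ‖v‖ ^ 2 := by
  obtain ⟨B, hB⟩ := hW.exists_matrix
  obtain ⟨hpos, hspec, hgrad⟩ := hB s
  have h1 := le_add_inner_gradient_add_sq hW.contDiff hW.lipschitz s (γ • v)
  have h2 : ⟪gradient (M.W hT) s, γ • v⟫ =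
      γ * (⟪Matrix.toEuclideanLin (B s) (v - M.h hT s), v⟫ -
        ⟪Matrix.toEuclideanLin (B s) v, v⟫) := by
    rw [hgrad, inner_smul_right, map_sub, inner_sub_left, inner_neg_left]
    ring
  have h3 := mul_le_mul_of_nonneg_left
    (mul_norm_sq_le_inner_toEuclideanLin hpos.isHermitian hspec v) hγ.le
  have h4 := mul_le_mul_of_nonneg_left (inner_toEuclideanLin_le hpos.isHermitian hW.vmin_pos.le
    hspec (v - M.h hT s) v (mul_pos hγ hC)) hγ.le
  have h5 : γ * (vmax / (2 * (γ * C)) * ‖v - M.h hT s‖ ^ 2 + vmax * (γ * C) / 2 * ‖v‖ ^ 2) =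
      vmax / (2 * C) * ‖v - M.h hT s‖ ^ 2 + γ ^ 2 * (vmax * C / 2) * ‖v‖ ^ 2 := by
    field_simp
  rw [norm_smul, mul_pow, Real.norm_of_nonneg hγ.le, h2] at h1
  rw [h5] at h4
  linarith

/-- A bound for the ratio between the root mean squares of `H - h(S)` and of `γ • H` along the path.
-/
noncomputable def errRatio (n : ℕ) (L ω : ℝ) : ℝ :=
  2 * Real.sqrt 2 * (L / Real.sqrt n) * (1 + ω) * Real.sqrt (ω + (1 + 10 * ω) / 8)

theorem errRatio_nonneg {n : ℕ} {L ω : ℝ} (hL : 0 ≤ L) (hω : 0 ≤ ω) : 0 ≤ errRatio n L ω := by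
  unfold errRatio
  positivity

theorem errRatio_sq {n : ℕ} {L ω : ℝ} (hω : 0 ≤ ω) :
    errRatio n L ω ^ 2 = L ^ 2 / n * (1 + ω) ^ 2 * (1 + 18 * ω) := by
  unfold errRatio
  rw [mul_pow, mul_pow, mul_pow, mul_pow, div_pow, Real.sq_sqrt (by norm_num),
    Real.sq_sqrt (by positivity), Real.sq_sqrt (by positivity)]
  ring

theorem stepSize_pos {n : ℕ} {vmin vmax LW L ω : ℝ} (hvmin : 0 < vmin) (hvmax : 0 ≤ vmax)
    (hLW : 0 < LW) (hL : 0 ≤ L) (hω : 0 ≤ ω) : 0 < stepSize n vmin vmax LW L ω := by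
  unfold stepSize
  positivity

/-- The step size balances the curvature and the error terms against half of `vmin`. -/
theorem stepSize_mul {n : ℕ} {vmin vmax LW L ω : ℝ} (hvmax : 0 ≤ vmax)
    (hLW : 0 < LW) (hL : 0 ≤ L) (hω : 0 ≤ ω) :
    stepSize n vmin vmax LW L ω * (vmax * errRatio n L ω + LW / 2) = vmin / 2 := by
  have h1 : 4 * Real.sqrt 2 * (vmax / LW) * (L / Real.sqrt n) * (1 + ω) *
      Real.sqrt (ω + (1 + 10 * ω) / 8) = 2 * (vmax / LW) * errRatio n L ω := by
    unfold errRatio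
    ring
  have h2 := errRatio_nonneg (n := n) hL hω
  have h3 : 1 + 2 * (vmax / LW) * errRatio n L ω ≠ 0 := by positivity
  have h4 : LW + 2 * vmax * errRatio n L ω ≠ 0 := by positivity
  unfold stepSize
  rw [h1]
  field_simp
  ring

theorem batchSize_pos {kin : ℕ} (hkin : 0 < kin) {ω : ℝ} (hω : 0 ≤ ω) :
    0 < batchSize kin ω := by
  have : (0 : ℝ) < kin := Nat.cast_pos.2 hkin
  exact Nat.ceil_pos.2 (by positivity)

/-- The mini-batches are large enough for the errors of a whole outer loop. -/
theorem kin_mul_div_batchSize_le {n kin : ℕ} (hn : 0 < n) (hkin : 0 < kin) {ω L : ℝ}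
    (hω : 0 ≤ ω) :
    kin * (L ^ 2 / (n * batchSize kin ω)) ≤ L ^ 2 * (1 + ω) ^ 2 / n := by
  have hb : (0 : ℝ) < batchSize kin ω := Nat.cast_pos.2 (batchSize_pos hkin hω)
  have hn' : (0 : ℝ) < n := Nat.cast_pos.2 hn
  have h1 : (kin : ℝ) ≤ batchSize kin ω * (1 + ω) ^ 2 :=
    (div_le_iff₀ (by positivity)).1 (Nat.le_ceil _)
  have h2 : kin * (L ^ 2 / (n * batchSize kin ω)) =
      L ^ 2 / (n * batchSize kin ω) * kin := mul_comm _ _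
  have h3 : L ^ 2 * (1 + ω) ^ 2 / n =
      L ^ 2 / (n * batchSize kin ω) * (batchSize kin ω * (1 + ω) ^ 2) := by field_simp
  rw [h2, h3]
  gcongr

/-! ### The convergence bounds -/

theorem measurable_of_lipschitz_sub_id {q : ℕ} {f : Vec q → Vec q} {K : ℝ}
    (hf : ∀ s s' : Vec q, ‖(f s - s) - (f s' - s')‖ ≤ K * ‖s - s'‖) : Measurable f := by
  have h : LipschitzWith K.toNNReal fun s => f s - s := LipschitzWith.of_dist_le_mul fun s s' => by
    rw [dist_eq_norm, dist_eq_norm]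
    exact (hf s s').trans (by gcongr; exact Real.le_coe_toNNReal K)
  have h' : f = fun s => (f s - s) + s := by simp
  rw [h']
  exact (h.continuous.add continuous_id).measurable

/-- The step size leaves room for half of the decrease `γ * vmin`, at every `C` which is at least
the error ratio. -/
theorem potential_decrease_le {n b kin : ℕ} {vmin vmax LW L ω γ κ C : ℝ}
    (hvmax : 0 ≤ vmax) (hω : 0 ≤ ω) (hC : 0 < C)
    (hCn : errRatio n L ω ^ 2 ≤ C ^ 2) (hκ : κ = L ^ 2 / (n * b))
    (hkin : kin * (L ^ 2 / (n * b)) ≤ L ^ 2 * (1 + ω) ^ 2 / n) :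
    (γ * vmin - γ ^ 2 * (vmax * C + LW / 2)) + vmax / (2 * C) * (kin * κ) * γ ^ 2 +
      vmax / (2 * C) / n * (6 * ω * (1 + ω) * (1 + 2 * ω) * L ^ 2) * γ ^ 2 ≤
      γ * vmin - γ ^ 2 * (vmax * C / 2 + LW / 2) := by
  rw [errRatio_sq hω] at hCn
  have hx : 0 ≤ L ^ 2 / n := by positivity
  have h1 : kin * κ + 6 * ω * (1 + ω) * (1 + 2 * ω) * (L ^ 2 / n) ≤ C ^ 2 := by
    rw [hκ]
    have h2 : L ^ 2 * (1 + ω) ^ 2 / n + 6 * ω * (1 + ω) * (1 + 2 * ω) * (L ^ 2 / n) =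
        L ^ 2 / n * ((1 + ω) ^ 2 + 6 * ω * (1 + ω) * (1 + 2 * ω)) := by ring
    have h3 : (1 + ω) ^ 2 + 6 * ω * (1 + ω) * (1 + 2 * ω) ≤ (1 + ω) ^ 2 * (1 + 18 * ω) := by
      have : 0 ≤ 6 * ω * (1 + ω) * (2 + ω) := by positivity
      linarith
    have h4 := mul_le_mul_of_nonneg_left h3 hx
    linarith
  have h5 : vmax / (2 * C) * (kin * κ) * γ ^ 2 +
      vmax / (2 * C) / n * (6 * ω * (1 + ω) * (1 + 2 * ω) * L ^ 2) * γ ^ 2 =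
      vmax / (2 * C) * γ ^ 2 * (kin * κ + 6 * ω * (1 + ω) * (1 + 2 * ω) * (L ^ 2 / n)) := by ring
  have h6 := mul_le_mul_of_nonneg_left h1 (by positivity : 0 ≤ vmax / (2 * C) * γ ^ 2)
  have h7 : vmax / (2 * C) * γ ^ 2 * C ^ 2 = γ ^ 2 * (vmax * C / 2) := by field_simp
  linarith

end VRFedEM

open VRFedEM in
theorem theorem2 {n m d q : ℕ} (hn : 0 < n) (hm : 0 < m)
    {Y Z : Type*} [MeasurableSpace Z]
    -- the model and the assumptions on it
    (M : VRFedEM.Model n m d q Y Z)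
    (hM : M.Regular) (hs : M.StatWellDefined) (hT : M.UniqueMStep)
    {LW vmin vmax : ℝ} (hW : M.Lyapunov hT LW vmin vmax)
    (hWbdd : BddBelow (Set.range (M.W hT)))
    {Lip : Fin n → Fin m → ℝ} (hLip : M.LipschitzStats hT Lip)
    -- the compression operator
    {Ξ : Type*} [MeasurableSpace Ξ] (ν : Measure Ξ) [IsProbabilityMeasure ν]
    (Q : Ξ → VRFedEM.Vec q → VRFedEM.Vec q) {ω : ℝ} (hQ : VRFedEM.IsCompressor ν Q ω)
    -- the random input of the algorithm
    {Ω : Type*} [MeasurableSpace Ω] (P : Measure Ω) [IsProbabilityMeasure P]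
    {kout kin : ℕ} (hkout : 0 < kout) (hkin : 0 < kin) (sch : VRFedEM.Sampling)
    (Sinit : Ω → VRFedEM.Vec q)
    (B : ℕ → ℕ → Fin n → Ω → Fin (VRFedEM.batchSize kin ω) → Fin m)
    (ξ : ℕ → ℕ → Fin n → Ω → Ξ)
    (hinput : VRFedEM.IsRandomInput P ν sch kout kin Sinit B ξ)
    (hinit : Integrable (fun x => M.W hT (Sinit x)) P)
    -- the parameters and the path of the algorithm
    {L γ : ℝ} (hL : L = VRFedEM.meanLip Lip)
    (hγ : γ = VRFedEM.stepSize n vmin vmax LW L ω)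
    (σ : ℕ → ℕ → Ω → VRFedEM.State n q)
    (hσ : ∀ t k x, σ t k x = VRFedEM.run (M.sbarT hT) Q (1 / (1 + ω)) (fun _ _ => γ) kin
      (Sinit x) (fun i => M.hLoc hT i (Sinit x)) (fun t k i => B t k i x)
      (fun t k i => ξ t k i x) t k)
    -- the random time, uniform and independent of the path
    (τ : Ω → Fin kout) (K : Ω → Fin kin)
    (hτK : Measurable fun x => (τ x, K x))
    (hunif : P.map (fun x => (τ x, K x)) = uniformOn Set.univ)
    (hindep : IndepFun (fun x => (τ x, K x))
      (fun x (p : Fin kout × Fin (kin + 1)) => (σ p.1 p.2 x).S) P) :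
    Integrable (fun x => ‖(σ (τ x) (K x + 1) x).H‖ ^ 2) P ∧
    Integrable (fun x => ‖M.h hT (σ (τ x) (K x) x).S‖ ^ 2) P ∧
    ∫ x, ‖(σ (τ x) (K x + 1) x).H‖ ^ 2 ∂P ≤
      2 * (∫ x, M.W hT (σ 0 0 x).S ∂P - ⨅ s, M.W hT s) / (vmin * γ * kin * kout) ∧
    ∫ x, ‖M.h hT (σ (τ x) (K x) x).S‖ ^ 2 ∂P ≤
      2 * (1 + γ ^ 2 * (L ^ 2 * (1 + ω) ^ 2 / n)) *
        ∫ x, ‖(σ (τ x) (K x + 1) x).H‖ ^ 2 ∂P := by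
  have hω := hQ.omega_nonneg
  have hvmin := hW.vmin_pos
  have hvmax : 0 < vmax := hvmin.trans_le hW.vmin_le_vmax
  have hL0 : 0 ≤ L := by rw [hL]; exact Real.sqrt_nonneg _
  have hγ0 : 0 < γ := by rw [hγ]; exact stepSize_pos hvmin hvmax.le hW.LW_pos hL0 hω
  have hγC : γ * (vmax * errRatio n L ω + LW / 2) = vmin / 2 := by
    rw [hγ]; exact stepSize_mul hvmax.le hW.LW_pos hL0 hω
  have hb := batchSize_pos hkin hω
  have hg : ∀ i j, Measurable (M.sbarT hT i j) := fun i j =>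
    measurable_of_lipschitz_sub_id (hLip i j)
  have hWm : Measurable (M.W hT) := hW.contDiff.continuous.measurable
  have hw : ∀ s, ⨅ s, M.W hT s ≤ M.W hT s := fun s => ciInf_le hWbdd s
  have : IsProbabilityMeasure (batchLaw (batchSize kin ω) m sch) := by
    rw [← hinput.law_batch ⟨0, hkout⟩ ⟨0, hkin⟩ ⟨0, hn⟩]
    exact Measure.isProbabilityMeasure_map (hinput.measurable_batch _ _ _).aemeasurable
  have hv₀ : ∀ i, Measurable fun s : Vec q => fullPass (M.sbarT hT) s i - s := fun i =>
    (measurable_fullPass hg i).sub measurable_id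
  set X := path (M.sbarT hT) Q (1 / (1 + ω)) γ kin Sinit
    (fun i s => fullPass (M.sbarT hT) s i - s) B ξ with hX
  have hσX : σ = X := by
    funext t k x
    exact hσ t k x
  subst hσX
  have hXm : ∀ t < kout, ∀ k ≤ kin, Measurable (X t k) := fun t ht k hk =>
    (measurable_path_past hg hQ.measurable _ γ hv₀ t ht k hk).mono (hinput.sigmaOf_le _) le_rfl
  -- the sums over all iterations
  set HH := ∑ t ∈ Finset.range kout, ∑ k ∈ Finset.range kin,
    ∫⁻ x, ENNReal.ofReal (‖(X t (k + 1) x).H‖ ^ 2) ∂P with hHH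
  set MM := ∑ t ∈ Finset.range kout, ∑ k ∈ Finset.range kin,
    ∫⁻ x, ENNReal.ofReal (‖M.h hT (X t k x).S‖ ^ 2) ∂P with hMM
  set D := ∫ x, M.W hT (Sinit x) ∂P - ⨅ s, M.W hT s with hD
  have hDlint : ∫⁻ x, ENNReal.ofReal (M.W hT (Sinit x) - ⨅ s, M.W hT s) ∂P =
      ENNReal.ofReal D := by
    have hint : Integrable (fun x => M.W hT (Sinit x) - ⨅ s, M.W hT s) P :=
      hinit.sub (integrable_const _)
    rw [← ofReal_integral_eq_lintegral_ofReal hint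
      (Filter.Eventually.of_forall fun x => sub_nonneg.2 (hw _)),
      integral_sub hinit (integrable_const _)]
    simp [hD]
  have hD0 : 0 ≤ D := by
    have := integral_mono (integrable_const (⨅ s, M.W hT s)) hinit fun x => hw (Sinit x)
    simpa [hD] using this
  -- the Young parameter has to be positive, also when the error ratio vanishes
  have hbound : ∀ ε > 0, 0 ≤ γ * vmin / 2 - γ ^ 2 * vmax * ε →
      ENNReal.ofReal (γ * vmin / 2 - γ ^ 2 * vmax * ε) * HH ≤ ENNReal.ofReal D := by
    intro ε hε hε'
    have hC0 := errRatio_nonneg (n := n) hL0 hω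
    have hC : 0 < errRatio n L ω + ε := by positivity
    have hc : γ * vmin - γ ^ 2 * (vmax * (errRatio n L ω + ε) + LW / 2) =
        γ * vmin / 2 - γ ^ 2 * vmax * ε := by
      linear_combination -γ * hγC
    rw [← hc] at hε' ⊢
    rw [← hDlint]
    have hdec := potential_decrease_le (b := batchSize kin ω) (kin := kin) (vmin := vmin)
      (LW := LW) (γ := γ) hvmax.le hω hC
      (pow_le_pow_left₀ hC0 (le_add_of_nonneg_right hε.le) 2) rfl
      (kin_mul_div_batchSize_le hn hkin hω)
    generalize errRatio n L ω + ε = C at hC hε' hdec ⊢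
    rw [hL] at hdec
    exact sum_lintegral_H_sq_le hQ hg hLip hn hb hm hinput hkin hWm hw hvmax.le hC
      (fun s v => hW.descent hγ0 hC s v) rfl hε' hdec
  have hHtop : HH ≠ ⊤ := by
    have hc : γ * vmin / 2 - γ ^ 2 * vmax * (vmin / (4 * γ * vmax)) = γ * vmin / 4 := by
      field_simp
      ring
    have h := hbound (vmin / (4 * γ * vmax)) (by positivity) (by rw [hc]; positivity)
    intro htop
    rw [hc, htop, ENNReal.mul_top (by simpa using mul_pos hγ0 hvmin)] at h
    exact absurd h (by simp)
  have hHreal : γ * vmin / 2 * HH.toReal ≤ D := by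
    -- let the excess `ε` over the error ratio tend to zero
    have hlim : Filter.Tendsto (fun ε : ℝ => (γ * vmin / 2 - γ ^ 2 * vmax * ε) * HH.toReal)
        (nhdsWithin 0 (Set.Ioi 0)) (nhds (γ * vmin / 2 * HH.toReal)) := by
      have hcont : Continuous fun ε : ℝ => (γ * vmin / 2 - γ ^ 2 * vmax * ε) * HH.toReal := by
        fun_prop
      simpa using (hcont.tendsto 0).mono_left nhdsWithin_le_nhds
    refine le_of_tendsto hlim (eventually_nhdsWithin_of_forall fun ε hε => ?_)
    rcases le_total 0 (γ * vmin / 2 - γ ^ 2 * vmax * ε) with hc | hc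
    · have h := ENNReal.toReal_mono ENNReal.ofReal_ne_top (hbound ε hε hc)
      rwa [ENNReal.toReal_mul, ENNReal.toReal_ofReal hc, ENNReal.toReal_ofReal hD0] at h
    · exact (mul_nonpos_of_nonpos_of_nonneg hc ENNReal.toReal_nonneg).trans hD0
  have hκ0 : 0 ≤ γ ^ 2 * (L ^ 2 * (1 + ω) ^ 2 / n) := by positivity
  have hMH : MM ≤ ENNReal.ofReal (2 * (1 + γ ^ 2 * (L ^ 2 * (1 + ω) ^ 2 / n))) * HH := by
    have h1 := sum_lintegral_meanErr_sq_le hQ hg hLip hn hb hm hinput (γ := γ) rfl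
    have h2 : ENNReal.ofReal (kin * (meanLip Lip ^ 2 / (n * batchSize kin ω)) * γ ^ 2) ≤
        ENNReal.ofReal (γ ^ 2 * (L ^ 2 * (1 + ω) ^ 2 / n)) := by
      refine ENNReal.ofReal_le_ofReal ?_
      rw [← hL, mul_comm (γ ^ 2)]
      gcongr
      exact kin_mul_div_batchSize_le hn hkin hω
    calc MM ≤ ∑ t ∈ Finset.range kout, ∑ k ∈ Finset.range kin,
          (2 * ∫⁻ x, ENNReal.ofReal (‖(X t (k + 1) x).H‖ ^ 2) ∂P +
            2 * ∫⁻ x, ENNReal.ofReal (‖meanErr (M.sbarT hT) (X t (k + 1) x)‖ ^ 2) ∂P) :=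
          Finset.sum_le_sum fun t ht => Finset.sum_le_sum fun k hk =>
            lintegral_meanField_sq_le hQ hg hinput (Finset.mem_range.1 ht) (Finset.mem_range.1 hk)
      _ = 2 * HH + 2 * ∑ t ∈ Finset.range kout, ∑ k ∈ Finset.range kin,
          ∫⁻ x, ENNReal.ofReal (‖meanErr (M.sbarT hT) (X t (k + 1) x)‖ ^ 2) ∂P := by
          simp only [Finset.sum_add_distrib, ← Finset.mul_sum, hHH]
      _ ≤ 2 * HH + 2 * (ENNReal.ofReal (γ ^ 2 * (L ^ 2 * (1 + ω) ^ 2 / n)) * HH) := by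
          gcongr
          exact h1.trans (by gcongr)
      _ = _ := by
          rw [ENNReal.ofReal_mul (p := 2) zero_le_two, ENNReal.ofReal_add zero_le_one hκ0]
          simp only [ENNReal.ofReal_ofNat, ENNReal.ofReal_one]
          ring
  -- evaluation at the random time
  have hpathm : Measurable fun x (p : Fin kout × Fin (kin + 1)) => (X p.1 p.2 x).S :=
    measurable_pi_iff.2 fun p =>
      measurable_S.comp (hXm p.1 p.1.2 p.2 (Nat.lt_succ_iff.1 p.2.2))
  have hhm : Measurable (M.h hT) := by
    have := measurable_fullPass hg
    change Measurable (meanField (M.sbarT hT))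
    unfold meanField
    fun_prop
  have hHS : ∀ t k x, (X t (k + 1) x).H = γ⁻¹ • ((X t (k + 1) x).S - (X t k x).S) := by
    intro t k x
    rw [hX, path_succ]
    simp [step, hγ0.ne']
  have hHτ : ∫⁻ x, ENNReal.ofReal (‖(X (τ x) (K x + 1) x).H‖ ^ 2) ∂P =
      ((kout * kin : ℕ) : ENNReal)⁻¹ * HH := by
    have h := lintegral_uniform_index hτK hpathm hunif hindep
      (f := fun p y => ENNReal.ofReal (‖γ⁻¹ • (y (p.1, p.2.succ) - y (p.1, p.2.castSucc))‖ ^ 2))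
      (fun p => by fun_prop)
    simp only [Fin.val_succ, Fin.val_castSucc, ← hHS, Fintype.card_prod, Fintype.card_fin,
      Fintype.sum_prod_type] at h
    rw [h, hHH, Finset.sum_range]
    simp only [Finset.sum_range]
  have hMτ : ∫⁻ x, ENNReal.ofReal (‖M.h hT (X (τ x) (K x) x).S‖ ^ 2) ∂P =
      ((kout * kin : ℕ) : ENNReal)⁻¹ * MM := by
    have h := lintegral_uniform_index hτK hpathm hunif hindep
      (f := fun p y => ENNReal.ofReal (‖M.h hT (y (p.1, p.2.castSucc))‖ ^ 2))
      (fun p => by fun_prop)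
    simp only [Fin.val_castSucc, Fintype.card_prod, Fintype.card_fin,
      Fintype.sum_prod_type] at h
    rw [h, hMM, Finset.sum_range]
    simp only [Finset.sum_range]
  have hmeasτ : ∀ F : Fin kout × Fin kin → Ω → ℝ, (∀ p, Measurable (F p)) →
      Measurable fun x => F (τ x, K x) x := fun F hF =>
    (measurable_from_prod_countable_right (f := fun p : (Fin kout × Fin kin) × Ω => F p.1 p.2)
      hF).comp (hτK.prodMk measurable_id)
  have hmH : Measurable fun x => ‖(X (τ x) (K x + 1) x).H‖ ^ 2 :=
    hmeasτ (fun p x => ‖(X p.1 (p.2 + 1) x).H‖ ^ 2) fun p =>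
      (measurable_H.comp (hXm p.1 p.1.2 (p.2 + 1) p.2.2)).norm.pow_const 2
  have hmM : Measurable fun x => ‖M.h hT (X (τ x) (K x) x).S‖ ^ 2 :=
    hmeasτ (fun p x => ‖M.h hT (X p.1 p.2 x).S‖ ^ 2) fun p =>
      (hhm.comp (measurable_S.comp (hXm p.1 p.1.2 p.2 p.2.2.le))).norm.pow_const 2
  have hN : (0 : ℝ) < kout * kin := by positivity
  have hNtop : ((kout * kin : ℕ) : ENNReal)⁻¹ ≠ ⊤ :=
    ENNReal.inv_ne_top.2 (Nat.cast_ne_zero.2 (Nat.mul_pos hkout hkin).ne')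
  have hMtop : MM ≠ ⊤ := ne_top_of_le_ne_top (ENNReal.mul_ne_top ENNReal.ofReal_ne_top hHtop) hMH
  have hHint : ∫ x, ‖(X (τ x) (K x + 1) x).H‖ ^ 2 ∂P = (kout * kin : ℝ)⁻¹ * HH.toReal := by
    rw [integral_eq_lintegral_of_nonneg_ae (Filter.Eventually.of_forall fun x => sq_nonneg _)
      hmH.aestronglyMeasurable, hHτ, ENNReal.toReal_mul, ENNReal.toReal_inv]
    simp
  have hMint : ∫ x, ‖M.h hT (X (τ x) (K x) x).S‖ ^ 2 ∂P = (kout * kin : ℝ)⁻¹ * MM.toReal := by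
    rw [integral_eq_lintegral_of_nonneg_ae (Filter.Eventually.of_forall fun x => sq_nonneg _)
      hmM.aestronglyMeasurable, hMτ, ENNReal.toReal_mul, ENNReal.toReal_inv]
    simp
  refine ⟨?_, ?_, ?_, ?_⟩
  · rw [← lintegral_ofReal_ne_top_iff_integrable hmH.aestronglyMeasurable
      (Filter.Eventually.of_forall fun x => sq_nonneg _), hHτ]
    exact ENNReal.mul_ne_top hNtop hHtop
  · rw [← lintegral_ofReal_ne_top_iff_integrable hmM.aestronglyMeasurable
      (Filter.Eventually.of_forall fun x => sq_nonneg _), hMτ]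
    exact ENNReal.mul_ne_top hNtop hMtop
  · change _ ≤ 2 * D / (vmin * γ * kin * kout)
    rw [hHint, le_div_iff₀ (by positivity)]
    have h : (kout * kin : ℝ)⁻¹ * HH.toReal * (vmin * γ * kin * kout) =
        2 * (γ * vmin / 2 * HH.toReal) := by field_simp
    rw [h]
    linarith
  · rw [hHint, hMint]
    have h := ENNReal.toReal_mono (ENNReal.mul_ne_top ENNReal.ofReal_ne_top hHtop) hMH
    rw [ENNReal.toReal_mul, ENNReal.toReal_ofReal (by positivity)] at h
    calc (kout * kin : ℝ)⁻¹ * MM.toReal ≤ (kout * kin : ℝ)⁻¹ *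
          (2 * (1 + γ ^ 2 * (L ^ 2 * (1 + ω) ^ 2 / n)) * HH.toReal) := by gcongr
      _ = _ := by ring
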